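/- Let $A$ be a Hopf algebra over $\mathbb{C}$ with coproduct $\Delta$, counit $\epsilon$ and antipode $S$. Let $E$ be a bicovariant $A$-bimodule, that is, an $A$-bimodule with a left coaction $\Delta_E : E \to A\otimes_{\mathbb C} E$ and a right coaction ${}_E\Delta : E \to E\otimes_{\mathbb C} A$ that commute with each other and satisfy $\Delta_E(ae)=\Delta(a)\Delta_E(e)$, $\Delta_E(ea)=\Delta_E(e)\Delta(a)$ and the analogous identities for ${}_E\Delta$. Assume that $E$ is finite: the space ${}_0E=\{e\in E:\Delta_E(e)=1\otimes e\}$ of left-invariant elements is finite-dimensional. Let $\sigma : E\otimes_A E\to E\otimes_A E$ be Woronowicz's braiding, the unique bimodule map with $\sigma(\omega\otimes\eta)=\eta\otimes\omega$ for $\omega$ left-invariant and $\eta$ right-invariant. Let $g : E\otimes_A E\to A$ be a pseudo-Riemannian metric that is bi-invariant and left as well as right $A$-linear; that is, $g$ is an $A$-bimodule map with $g\circ\sigma=g$, such that $g(\rho\otimes\nu)=0$ for all $\nu\in E$ implies $\rho=0$, and such that $(\mathrm{id}\otimes\epsilon g)\circ\Delta_{E\otimes_A E}=g$ and $(\epsilon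 g\otimes\mathrm{id})\circ{}_{E\otimes_A E}\Delta=g$. Let $E^*=\mathrm{Hom}_A(E,A)$ be the bimodule of right $A$-linear maps, with $(a\varphi b)(e)=a\,\varphi(be)$, and let $V_g : E\to E^*$, $V_g(e)(f)=g(e\otimes f)$. Then there is exactly one bicovariant bimodule structure on the bimodule $E^*$ for which the evaluation map $E^*\otimes_A E\to A$ is a morphism of bicovariant bimodules. With this structure, $E^*$ together with the evaluation map is a left dual of $E$ in the monoidal category of bicovariant $A$-bimodules, and $V_g : E\to E^*$ is an isomorphism of bicovariant bimodules. Consequently, if $(\widetilde E,\mathrm{ev},\mathrm{coev})$ is any left dual of $E$ in this category, then $\kappa : \widetilde E\to E^*$, $\kappa(x)(e)=\mathrm{ev}(x\otimes e)$, is an isomorphism of bicovariant bimodules, and so is $\kappa^{-1}\circ V_g : E\to\widetilde E$. -/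

import Mathlib

set_option linter.unusedSectionVars false

open scoped TensorProduct
open MulOpposite (op)

noncomputable section

namespace HopfBimod

/-! Bimodules over a complex algebra: a left `A`-module and right `A`-module (a module over
`Aᵐᵒᵖ`, with `op a • m` standing for `m a`), the two actions commuting. -/

section Actions

variable (A : Type*) (M : Type*) [Ring A] [Algebra ℂ A] [AddCommGroup M] [Module ℂ M]
  [Module A M] [Module Aᵐᵒᵖ M] [IsScalarTower ℂ A M] [IsScalarTower ℂ Aᵐᵒᵖ M]

/-- The left action `a ↦ m ↦ a m` as a bilinear map. -/
def lact : A →ₗ[ℂ] M →ₗ[ℂ] M :=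
  LinearMap.mk₂ ℂ (fun a m => a • m) (fun _ _ _ => add_smul _ _ _) (fun _ _ _ => smul_assoc _ _ _)
    (fun _ _ _ => smul_add _ _ _) (fun c a m => (smul_comm c a m).symm)

/-- The right action `m ↦ a ↦ m a` as a bilinear map. -/
def ract : M →ₗ[ℂ] A →ₗ[ℂ] M :=
  LinearMap.mk₂ ℂ (fun m a => op a • m) (fun _ _ _ => smul_add _ _ _)
    (fun c m a => (smul_comm c (op a) m).symm)
    (fun _ _ _ => by rw [MulOpposite.op_add, add_smul])
    (fun c m a => by rw [MulOpposite.op_smul, smul_assoc])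

@[simp] theorem lact_apply (a : A) (m : M) : lact A M a m = a • m := rfl

@[simp] theorem ract_apply (a : A) (m : M) : ract A M m a = op a • m := rfl

end Actions

section BalancedTensor

variable (A : Type*) (M N : Type*) [Ring A] [Algebra ℂ A]
  [AddCommGroup M] [Module ℂ M] [Module A M] [Module Aᵐᵒᵖ M]
  [IsScalarTower ℂ A M] [IsScalarTower ℂ Aᵐᵒᵖ M] [SMulCommClass A Aᵐᵒᵖ M]
  [AddCommGroup N] [Module ℂ N] [Module A N] [Module Aᵐᵒᵖ N]
  [IsScalarTower ℂ A N] [IsScalarTower ℂ Aᵐᵒᵖ N] [SMulCommClass A Aᵐᵒᵖ N]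

/-- The relations `m a ⊗ n = m ⊗ a n`. -/
def balancedRel : Submodule ℂ (M ⊗[ℂ] N) :=
  Submodule.span ℂ {t | ∃ (m : M) (a : A) (n : N), t = (op a • m) ⊗ₜ[ℂ] n - m ⊗ₜ[ℂ] (a • n)}

/-- The tensor product `M ⊗_A N` over the (noncommutative) algebra `A`. -/
def BTensor : Type _ := (M ⊗[ℂ] N) ⧸ balancedRel A M N

instance : AddCommGroup (BTensor A M N) :=
  inferInstanceAs (AddCommGroup ((M ⊗[ℂ] N) ⧸ balancedRel A M N))

instance : Module ℂ (BTensor A M N) :=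
  inferInstanceAs (Module ℂ ((M ⊗[ℂ] N) ⧸ balancedRel A M N))

namespace BTensor

/-- The class `m ⊗ n` in `M ⊗_A N`. -/
def mk : M →ₗ[ℂ] N →ₗ[ℂ] BTensor A M N :=
  (TensorProduct.mk ℂ M N).compr₂ (balancedRel A M N).mkQ

variable {A M N}

theorem mk_balanced (m : M) (a : A) (n : N) :
    mk A M N (op a • m) n = mk A M N m (a • n) :=
  (Submodule.Quotient.eq _).2 (Submodule.subset_span ⟨m, a, n, rfl⟩)

theorem induction_on {P : BTensor A M N → Prop} (t : BTensor A M N) (zero : P 0)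
    (tmul : ∀ m n, P (mk A M N m n)) (add : ∀ s t, P s → P t → P (s + t)) : P t := by
  obtain ⟨x, rfl⟩ := Submodule.mkQ_surjective (balancedRel A M N) t
  induction x with
  | zero => exact zero
  | tmul m n => exact tmul m n
  | add x y hx hy => rw [map_add]; exact add _ _ hx hy

/-- A balanced bilinear map induces a linear map on `M ⊗_A N`. -/
def lift {P : Type*} [AddCommGroup P] [Module ℂ P] (f : M →ₗ[ℂ] N →ₗ[ℂ] P)
    (h : ∀ (m : M) (a : A) (n : N), f (op a • m) n = f m (a • n)) : BTensor A M N →ₗ[ℂ] P :=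
  (balancedRel A M N).liftQ (TensorProduct.lift f) (by
    refine Submodule.span_le.2 ?_
    rintro _ ⟨m, a, n, rfl⟩
    simp [h])

@[simp] theorem lift_mk {P : Type*} [AddCommGroup P] [Module ℂ P] (f : M →ₗ[ℂ] N →ₗ[ℂ] P)
    (h : ∀ (m : M) (a : A) (n : N), f (op a • m) n = f m (a • n)) (m : M) (n : N) :
    lift f h (mk A M N m n) = f m n := rfl

/-- `a (m ⊗ n) = a m ⊗ n`. -/
def leftMul (a : A) : BTensor A M N →ₗ[ℂ] BTensor A M N :=
  lift ((mk A M N).comp (lact A M a)) (fun m b n => by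
    simp only [LinearMap.comp_apply, lact_apply]
    rw [smul_comm a (op b) m, mk_balanced])

/-- `(m ⊗ n) a = m ⊗ n a`. -/
def rightMul (a : A) : BTensor A M N →ₗ[ℂ] BTensor A M N :=
  lift ((mk A M N).compl₂ ((ract A N).flip a)) (fun m b n => by
    simp only [LinearMap.compl₂_apply, LinearMap.flip_apply, ract_apply]
    rw [← smul_comm b (op a) n, mk_balanced])

instance : SMul A (BTensor A M N) := ⟨fun a t => leftMul a t⟩

instance : SMul Aᵐᵒᵖ (BTensor A M N) := ⟨fun a t => rightMul a.unop t⟩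

@[simp] theorem smul_mk (a : A) (m : M) (n : N) : a • mk A M N m n = mk A M N (a • m) n := rfl

@[simp] theorem op_smul_mk (a : A) (m : M) (n : N) :
    op a • mk A M N m n = mk A M N m (op a • n) := rfl

theorem smul_def (a : A) (t : BTensor A M N) : a • t = leftMul a t := rfl

theorem op_smul_def (a : Aᵐᵒᵖ) (t : BTensor A M N) : a • t = rightMul a.unop t := rfl

theorem leftMul_mk (a : A) (m : M) (n : N) :
    leftMul a (mk A M N m n) = mk A M N (a • m) n := rfl

theorem rightMul_mk (a : A) (m : M) (n : N) :
    rightMul a (mk A M N m n) = mk A M N m (op a • n) := rfl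

instance : Module A (BTensor A M N) where
  one_smul t := by
    induction t using induction_on with
    | zero => simp [smul_def]
    | tmul m n => simp
    | add s t hs ht => simp only [smul_def, map_add] at *; rw [hs, ht]
  mul_smul a b t := by
    induction t using induction_on with
    | zero => simp [smul_def]
    | tmul m n => simp [mul_smul]
    | add s t hs ht => simp only [smul_def, map_add] at *; rw [hs, ht]
  smul_zero a := by simp [smul_def]
  smul_add a s t := by simp [smul_def]
  add_smul a b t := by
    induction t using induction_on with
    | zero => simp [smul_def]
    | tmul m n => simp [add_smul]
    | add s t hs ht => simp only [smul_def, map_add] at *; rw [hs, ht]; abel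
  zero_smul t := by
    induction t using induction_on with
    | zero => simp [smul_def]
    | tmul m n => simp
    | add s t hs ht => simp only [smul_def, map_add] at *; rw [hs, ht]; simp

instance : Module Aᵐᵒᵖ (BTensor A M N) where
  one_smul t := by
    induction t using induction_on with
    | zero => simp [op_smul_def]
    | tmul m n => simp [op_smul_def, rightMul_mk]
    | add s t hs ht => simp only [op_smul_def, map_add] at *; rw [hs, ht]
  mul_smul a b t := by
    induction t using induction_on with
    | zero => simp [op_smul_def]
    | tmul m n => simp [op_smul_def, rightMul_mk, mul_smul]
    | add s t hs ht => simp only [op_smul_def, map_add] at *; rw [hs, ht]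
  smul_zero a := by simp [op_smul_def]
  smul_add a s t := by simp [op_smul_def]
  add_smul a b t := by
    induction t using induction_on with
    | zero => simp [op_smul_def]
    | tmul m n => simp [op_smul_def, rightMul_mk, add_smul]
    | add s t hs ht => simp only [op_smul_def, map_add] at *; rw [hs, ht]; abel
  zero_smul t := by
    induction t using induction_on with
    | zero => simp [op_smul_def]
    | tmul m n => simp [op_smul_def, rightMul_mk]
    | add s t hs ht => simp only [op_smul_def, map_add] at *; rw [hs, ht]; simp

instance : IsScalarTower ℂ A (BTensor A M N) where
  smul_assoc c a t := by
    induction t using induction_on with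
    | zero => simp
    | tmul m n => simp [smul_assoc]
    | add s t hs ht => simp only [smul_add, hs, ht]

instance : IsScalarTower ℂ Aᵐᵒᵖ (BTensor A M N) where
  smul_assoc c a t := by
    induction t using induction_on with
    | zero => simp
    | tmul m n => simp [op_smul_def, rightMul_mk, smul_assoc]
    | add s t hs ht => simp only [smul_add, hs, ht]

instance : SMulCommClass A Aᵐᵒᵖ (BTensor A M N) where
  smul_comm a b t := by
    induction t using induction_on with
    | zero => simp
    | tmul m n => simp [op_smul_def, rightMul_mk]
    | add s t hs ht => simp only [smul_add, hs, ht]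

end BTensor

end BalancedTensor

section Dual

variable (A : Type*) (M : Type*) [Ring A] [Algebra ℂ A] [AddCommGroup M] [Module ℂ M]
  [Module A M] [Module Aᵐᵒᵖ M] [IsScalarTower ℂ A M] [IsScalarTower ℂ Aᵐᵒᵖ M]
  [SMulCommClass A Aᵐᵒᵖ M]

/-- `M* = Hom_A(M, A)`, the right `A`-linear maps from `M` to `A`. -/
def RDual : Type _ := M →ₗ[Aᵐᵒᵖ] A

namespace RDual

instance : AddCommGroup (RDual A M) := inferInstanceAs (AddCommGroup (M →ₗ[Aᵐᵒᵖ] A))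

instance : Module ℂ (RDual A M) := inferInstanceAs (Module ℂ (M →ₗ[Aᵐᵒᵖ] A))

/-- The left action `(a φ)(m) = a φ(m)`. -/
instance : Module A (RDual A M) := inferInstanceAs (Module A (M →ₗ[Aᵐᵒᵖ] A))

instance : FunLike (RDual A M) M A := inferInstanceAs (FunLike (M →ₗ[Aᵐᵒᵖ] A) M A)

instance : LinearMapClass (RDual A M) Aᵐᵒᵖ M A :=
  inferInstanceAs (LinearMapClass (M →ₗ[Aᵐᵒᵖ] A) Aᵐᵒᵖ M A)

variable {A M}

@[ext] theorem ext {φ ψ : RDual A M} (h : ∀ m, φ m = ψ m) : φ = ψ := DFunLike.ext φ ψ h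

@[simp] theorem add_apply (φ ψ : RDual A M) (m : M) : (φ + ψ) m = φ m + ψ m := rfl

@[simp] theorem zero_apply (m : M) : (0 : RDual A M) m = 0 := rfl

@[simp] theorem smul_apply (a : A) (φ : RDual A M) (m : M) : (a • φ) m = a * φ m := rfl

@[simp] theorem csmul_apply (c : ℂ) (φ : RDual A M) (m : M) : (c • φ) m = c • φ m := rfl

theorem map_op_smul (φ : RDual A M) (a : A) (m : M) : φ (op a • m) = φ m * a :=
  map_smul φ (op a) m

theorem map_csmul (φ : RDual A M) (c : ℂ) (m : M) : φ (c • m) = c • φ m :=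
  ((φ : M →ₗ[Aᵐᵒᵖ] A).restrictScalars ℂ).map_smul c m

/-- The right action `(φ a)(m) = φ(a m)`. -/
instance : Module Aᵐᵒᵖ (RDual A M) where
  smul a φ := LinearMap.comp (φ : M →ₗ[Aᵐᵒᵖ] A)
    ({ toFun := fun m => a.unop • m
       map_add' := fun _ _ => smul_add _ _ _
       map_smul' := fun b m => smul_comm a.unop b m } : M →ₗ[Aᵐᵒᵖ] M)
  one_smul φ := ext fun m => congrArg φ (one_smul A m)
  mul_smul a b φ := ext fun m => congrArg φ (mul_smul b.unop a.unop m)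
  smul_zero _ := rfl
  smul_add _ _ _ := rfl
  add_smul a b φ := ext fun m => (congrArg φ (add_smul a.unop b.unop m)).trans (map_add φ _ _)
  zero_smul φ := ext fun m => (congrArg φ (zero_smul A m)).trans (map_zero φ)

@[simp] theorem op_smul_apply (a : A) (φ : RDual A M) (m : M) : (op a • φ) m = φ (a • m) := rfl

instance : IsScalarTower ℂ A (RDual A M) where
  smul_assoc c a φ := ext fun m => by simp

instance : IsScalarTower ℂ Aᵐᵒᵖ (RDual A M) where
  smul_assoc c a φ := ext fun m => by
    change φ ((c • a.unop) • m) = c • φ (a.unop • m)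
    rw [smul_assoc, map_csmul]

instance : SMulCommClass A Aᵐᵒᵖ (RDual A M) where
  smul_comm _ _ _ := rfl

end RDual

end Dual

section Coactions

open Coalgebra TensorProduct

variable (A : Type*) [Ring A] [HopfAlgebra ℂ A]

/-- A bicovariant bimodule structure over the Hopf algebra `A` on the `A`-bimodule `M`: a left
coaction `left : M → A ⊗ M` and a right coaction `right : M → M ⊗ A` which commute and are both
compatible with the two module structures. -/
structure Bicovariant (M : Type*) [AddCommGroup M] [Module ℂ M] [Module A M] [Module Aᵐᵒᵖ M]
    [IsScalarTower ℂ A M] [IsScalarTower ℂ Aᵐᵒᵖ M] [SMulCommClass A Aᵐᵒᵖ M] where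
  left : M →ₗ[ℂ] A ⊗[ℂ] M
  right : M →ₗ[ℂ] M ⊗[ℂ] A
  /-- `(Δ ⊗ id) Δ_M = (id ⊗ Δ_M) Δ_M` -/
  left_coassoc : ∀ m, TensorProduct.assoc ℂ A A M (comul.rTensor M (left m)) =
    left.lTensor A (left m)
  left_counit : ∀ m, TensorProduct.lid ℂ M (counit.rTensor M (left m)) = m
  /-- `(_M Δ ⊗ id) _M Δ = (id ⊗ Δ) _M Δ` -/
  right_coassoc : ∀ m, TensorProduct.assoc ℂ M A A (right.rTensor A (right m)) =
    comul.lTensor M (right m)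
  right_counit : ∀ m, TensorProduct.rid ℂ M (counit.lTensor M (right m)) = m
  /-- `Δ_M (a m) = Δ(a) Δ_M(m)` -/
  left_smul : ∀ (a : A) (m : M), left (a • m) =
    map₂ (LinearMap.mul ℂ A) (lact A M) (comul a) (left m)
  /-- `Δ_M (m a) = Δ_M(m) Δ(a)` -/
  left_op_smul : ∀ (a : A) (m : M), left (op a • m) =
    map₂ (LinearMap.mul ℂ A) (ract A M) (left m) (comul a)
  /-- `_M Δ (a m) = Δ(a) _M Δ(m)` -/
  right_smul : ∀ (a : A) (m : M), right (a • m) =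
    map₂ (lact A M) (LinearMap.mul ℂ A) (comul a) (right m)
  /-- `_M Δ (m a) = _M Δ(m) Δ(a)` -/
  right_op_smul : ∀ (a : A) (m : M), right (op a • m) =
    map₂ (ract A M) (LinearMap.mul ℂ A) (right m) (comul a)
  /-- `(id ⊗ _M Δ) Δ_M = (Δ_M ⊗ id) _M Δ` -/
  left_right_comm : ∀ m, right.lTensor A (left m) =
    TensorProduct.assoc ℂ A M A (left.rTensor A (right m))

variable {A}

theorem comul_mul_eq (a b : A) : (comul (a * b) : A ⊗[ℂ] A) =
    map₂ (LinearMap.mul ℂ A) (LinearMap.mul ℂ A) (comul a) (comul b) := by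
  rw [Bialgebra.comul_mul]
  generalize (comul a : A ⊗[ℂ] A) = x
  generalize (comul b : A ⊗[ℂ] A) = y
  induction x with
  | zero => simp
  | add x x' h h' => simp only [add_mul, map_add, LinearMap.add_apply, h, h']
  | tmul p q =>
    induction y with
    | zero => simp
    | add x x' h h' => simp only [mul_add, map_add, h, h']
    | tmul r s => simp

variable (A) in
/-- The Hopf algebra `A` itself, with its coproduct as left and right coaction. -/
def Bicovariant.unit : Bicovariant A A where
  left := comul
  right := comul
  left_coassoc := coassoc_apply
  left_counit m := by simp
  right_coassoc := coassoc_apply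
  right_counit m := by simp
  left_smul := comul_mul_eq
  left_op_smul a m := comul_mul_eq m a
  right_smul := comul_mul_eq
  right_op_smul a m := comul_mul_eq m a
  left_right_comm m := (coassoc_apply m).symm

variable {M : Type*} [AddCommGroup M] [Module ℂ M] [Module A M] [Module Aᵐᵒᵖ M]
  [IsScalarTower ℂ A M] [IsScalarTower ℂ Aᵐᵒᵖ M] [SMulCommClass A Aᵐᵒᵖ M]
  {N : Type*} [AddCommGroup N] [Module ℂ N] [Module A N] [Module Aᵐᵒᵖ N]
  [IsScalarTower ℂ A N] [IsScalarTower ℂ Aᵐᵒᵖ N] [SMulCommClass A Aᵐᵒᵖ N]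
  {P : Type*} [AddCommGroup P] [Module ℂ P] [Module A P] [Module Aᵐᵒᵖ P]
  [IsScalarTower ℂ A P] [IsScalarTower ℂ Aᵐᵒᵖ P] [SMulCommClass A Aᵐᵒᵖ P]

namespace BTensor

variable (A M N) in
/-- `(a ⊗ m) · (b ⊗ n) = a b ⊗ (m ⊗ n)`. -/
def leftPair : A ⊗[ℂ] M →ₗ[ℂ] A ⊗[ℂ] N →ₗ[ℂ] A ⊗[ℂ] BTensor A M N :=
  map₂ (LinearMap.mul ℂ A) (mk A M N)

variable (A M N) in
/-- `(m ⊗ a) · (n ⊗ b) = (m ⊗ n) ⊗ a b`. -/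
def rightPair : M ⊗[ℂ] A →ₗ[ℂ] N ⊗[ℂ] A →ₗ[ℂ] BTensor A M N ⊗[ℂ] A :=
  map₂ (mk A M N) (LinearMap.mul ℂ A)

theorem leftPair_balanced (X : A ⊗[ℂ] M) (D : A ⊗[ℂ] A) (Y : A ⊗[ℂ] N) :
    leftPair A M N (map₂ (LinearMap.mul ℂ A) (ract A M) X D) Y =
      leftPair A M N X (map₂ (LinearMap.mul ℂ A) (lact A N) D Y) := by
  induction X with
  | zero => simp
  | add _ _ h h' => simp only [map_add, LinearMap.add_apply, h, h']
  | tmul a m =>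
    induction D with
    | zero => simp
    | add _ _ h h' => simp only [map_add, LinearMap.add_apply, h, h']
    | tmul c d =>
      induction Y with
      | zero => simp
      | add _ _ h h' => simp only [map_add, h, h']
      | tmul b n => simp [leftPair, mul_assoc, mk_balanced]

theorem rightPair_balanced (X : M ⊗[ℂ] A) (D : A ⊗[ℂ] A) (Y : N ⊗[ℂ] A) :
    rightPair A M N (map₂ (ract A M) (LinearMap.mul ℂ A) X D) Y =
      rightPair A M N X (map₂ (lact A N) (LinearMap.mul ℂ A) D Y) := by
  induction X with
  | zero => simp
  | add _ _ h h' => simp only [map_add, LinearMap.add_apply, h, h']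
  | tmul m a =>
    induction D with
    | zero => simp
    | add _ _ h h' => simp only [map_add, LinearMap.add_apply, h, h']
    | tmul c d =>
      induction Y with
      | zero => simp
      | add _ _ h h' => simp only [map_add, h, h']
      | tmul n b => simp [rightPair, mul_assoc, mk_balanced]

theorem leftPair_smul (D : A ⊗[ℂ] A) (X : A ⊗[ℂ] M) (Y : A ⊗[ℂ] N) :
    leftPair A M N (map₂ (LinearMap.mul ℂ A) (lact A M) D X) Y =
      map₂ (LinearMap.mul ℂ A) (lact A (BTensor A M N)) D (leftPair A M N X Y) := by
  induction X with
  | zero => simp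
  | add _ _ h h' => simp only [map_add, LinearMap.add_apply, h, h']
  | tmul a m =>
    induction D with
    | zero => simp
    | add _ _ h h' => simp only [map_add, LinearMap.add_apply, h, h']
    | tmul c d =>
      induction Y with
      | zero => simp
      | add _ _ h h' => simp only [map_add, h, h']
      | tmul b n => simp [leftPair, mul_assoc]

theorem leftPair_op_smul (D : A ⊗[ℂ] A) (X : A ⊗[ℂ] M) (Y : A ⊗[ℂ] N) :
    leftPair A M N X (map₂ (LinearMap.mul ℂ A) (ract A N) Y D) =
      map₂ (LinearMap.mul ℂ A) (ract A (BTensor A M N)) (leftPair A M N X Y) D := by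
  induction X with
  | zero => simp
  | add _ _ h h' => simp only [map_add, LinearMap.add_apply, h, h']
  | tmul a m =>
    induction D with
    | zero => simp
    | add _ _ h h' => simp only [map_add, h, h']
    | tmul c d =>
      induction Y with
      | zero => simp
      | add _ _ h h' => simp only [map_add, LinearMap.add_apply, h, h']
      | tmul b n => simp [leftPair, mul_assoc]

theorem rightPair_smul (D : A ⊗[ℂ] A) (X : M ⊗[ℂ] A) (Y : N ⊗[ℂ] A) :
    rightPair A M N (map₂ (lact A M) (LinearMap.mul ℂ A) D X) Y =
      map₂ (lact A (BTensor A M N)) (LinearMap.mul ℂ A) D (rightPair A M N X Y) := by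
  induction X with
  | zero => simp
  | add _ _ h h' => simp only [map_add, LinearMap.add_apply, h, h']
  | tmul m a =>
    induction D with
    | zero => simp
    | add _ _ h h' => simp only [map_add, LinearMap.add_apply, h, h']
    | tmul c d =>
      induction Y with
      | zero => simp
      | add _ _ h h' => simp only [map_add, h, h']
      | tmul n b => simp [rightPair, mul_assoc]

theorem rightPair_op_smul (D : A ⊗[ℂ] A) (X : M ⊗[ℂ] A) (Y : N ⊗[ℂ] A) :
    rightPair A M N X (map₂ (ract A N) (LinearMap.mul ℂ A) Y D) =
      map₂ (ract A (BTensor A M N)) (LinearMap.mul ℂ A) (rightPair A M N X Y) D := by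
  induction X with
  | zero => simp
  | add _ _ h h' => simp only [map_add, LinearMap.add_apply, h, h']
  | tmul m a =>
    induction D with
    | zero => simp
    | add _ _ h h' => simp only [map_add, h, h']
    | tmul c d =>
      induction Y with
      | zero => simp
      | add _ _ h h' => simp only [map_add, LinearMap.add_apply, h, h']
      | tmul n b => simp [rightPair, mul_assoc]

/-- `Δ_{M ⊗_A N} (m ⊗ n) = m₍₋₁₎ n₍₋₁₎ ⊗ (m₍₀₎ ⊗ n₍₀₎)`. -/
def leftCoaction (cM : Bicovariant A M) (cN : Bicovariant A N) :
    BTensor A M N →ₗ[ℂ] A ⊗[ℂ] BTensor A M N :=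
  lift ((leftPair A M N).compl₁₂ cM.left cN.left) (fun m a n => by
    simp only [LinearMap.compl₁₂_apply, cM.left_op_smul, cN.left_smul, leftPair_balanced])

/-- `_{M ⊗_A N} Δ (m ⊗ n) = (m₍₀₎ ⊗ n₍₀₎) ⊗ m₍₁₎ n₍₁₎`. -/
def rightCoaction (cM : Bicovariant A M) (cN : Bicovariant A N) :
    BTensor A M N →ₗ[ℂ] BTensor A M N ⊗[ℂ] A :=
  lift ((rightPair A M N).compl₁₂ cM.right cN.right) (fun m a n => by
    simp only [LinearMap.compl₁₂_apply, cM.right_op_smul, cN.right_smul, rightPair_balanced])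

theorem leftCoaction_mk (cM : Bicovariant A M) (cN : Bicovariant A N) (m : M) (n : N) :
    leftCoaction cM cN (mk A M N m n) = leftPair A M N (cM.left m) (cN.left n) := rfl

theorem rightCoaction_mk (cM : Bicovariant A M) (cN : Bicovariant A N) (m : M) (n : N) :
    rightCoaction cM cN (mk A M N m n) = rightPair A M N (cM.right m) (cN.right n) := rfl

theorem comul_leftPair (X : A ⊗[ℂ] M) (Y : A ⊗[ℂ] N) :
    TensorProduct.assoc ℂ A A _ (comul.rTensor _ (leftPair A M N X Y)) =
      map₂ (LinearMap.mul ℂ A) (leftPair A M N)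
        (TensorProduct.assoc ℂ A A M (comul.rTensor M X))
        (TensorProduct.assoc ℂ A A N (comul.rTensor N Y)) := by
  induction X with
  | zero => simp
  | add _ _ h h' => simp only [map_add, LinearMap.add_apply, h, h']
  | tmul a m =>
    induction Y with
    | zero => simp
    | add _ _ h h' => simp only [map_add, h, h']
    | tmul b n =>
      simp only [leftPair, map₂_apply_tmul, TensorProduct.map_tmul, LinearMap.mul_apply',
        LinearMap.rTensor_tmul,
        comul_mul_eq]
      generalize (comul a : A ⊗[ℂ] A) = x
      generalize (comul b : A ⊗[ℂ] A) = y
      induction x with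
      | zero => simp
      | add _ _ h h' => simp only [map_add, LinearMap.add_apply, add_tmul, h, h']
      | tmul p q =>
        induction y with
        | zero => simp
        | add _ _ h h' => simp only [map_add, add_tmul, h, h']
        | tmul r s => simp

theorem comul_rightPair (X : M ⊗[ℂ] A) (Y : N ⊗[ℂ] A) :
    (TensorProduct.assoc ℂ _ A A).symm (comul.lTensor _ (rightPair A M N X Y)) =
      map₂ (rightPair A M N) (LinearMap.mul ℂ A)
        ((TensorProduct.assoc ℂ M A A).symm (comul.lTensor M X))
        ((TensorProduct.assoc ℂ N A A).symm (comul.lTensor N Y)) := by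
  induction X with
  | zero => simp
  | add _ _ h h' => simp only [map_add, LinearMap.add_apply, h, h']
  | tmul m a =>
    induction Y with
    | zero => simp
    | add _ _ h h' => simp only [map_add, h, h']
    | tmul n b =>
      simp only [rightPair, map₂_apply_tmul, TensorProduct.map_tmul, LinearMap.mul_apply',
        LinearMap.lTensor_tmul,
        comul_mul_eq]
      generalize (comul a : A ⊗[ℂ] A) = x
      generalize (comul b : A ⊗[ℂ] A) = y
      induction x with
      | zero => simp
      | add _ _ h h' => simp only [map_add, LinearMap.add_apply, tmul_add, h, h']
      | tmul p q =>
        induction y with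
        | zero => simp
        | add _ _ h h' => simp only [map_add, tmul_add, h, h']
        | tmul r s => simp

theorem leftCoaction_leftPair (cM : Bicovariant A M) (cN : Bicovariant A N) (X : A ⊗[ℂ] M)
    (Y : A ⊗[ℂ] N) :
    (leftCoaction cM cN).lTensor A (leftPair A M N X Y) =
      map₂ (LinearMap.mul ℂ A) (leftPair A M N) (cM.left.lTensor A X) (cN.left.lTensor A Y) := by
  induction X with
  | zero => simp
  | add _ _ h h' => simp only [map_add, LinearMap.add_apply, h, h']
  | tmul a m =>
    induction Y with
    | zero => simp
    | add _ _ h h' => simp only [map_add, h, h']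
    | tmul b n => simp [leftPair, leftCoaction_mk]

theorem rightCoaction_rightPair (cM : Bicovariant A M) (cN : Bicovariant A N) (X : M ⊗[ℂ] A)
    (Y : N ⊗[ℂ] A) :
    (rightCoaction cM cN).rTensor A (rightPair A M N X Y) =
      map₂ (rightPair A M N) (LinearMap.mul ℂ A) (cM.right.rTensor A X)
        (cN.right.rTensor A Y) := by
  induction X with
  | zero => simp
  | add _ _ h h' => simp only [map_add, LinearMap.add_apply, h, h']
  | tmul a m =>
    induction Y with
    | zero => simp
    | add _ _ h h' => simp only [map_add, h, h']
    | tmul b n => simp [rightPair, rightCoaction_mk]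

theorem rightCoaction_leftPair (cM : Bicovariant A M) (cN : Bicovariant A N) (X : A ⊗[ℂ] M)
    (Y : A ⊗[ℂ] N) :
    (rightCoaction cM cN).lTensor A (leftPair A M N X Y) =
      map₂ (LinearMap.mul ℂ A) (rightPair A M N) (cM.right.lTensor A X)
        (cN.right.lTensor A Y) := by
  induction X with
  | zero => simp
  | add _ _ h h' => simp only [map_add, LinearMap.add_apply, h, h']
  | tmul a m =>
    induction Y with
    | zero => simp
    | add _ _ h h' => simp only [map_add, h, h']
    | tmul b n => simp [leftPair, rightCoaction_mk]

theorem leftCoaction_rightPair (cM : Bicovariant A M) (cN : Bicovariant A N) (X : M ⊗[ℂ] A)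
    (Y : N ⊗[ℂ] A) :
    (leftCoaction cM cN).rTensor A (rightPair A M N X Y) =
      map₂ (leftPair A M N) (LinearMap.mul ℂ A) (cM.left.rTensor A X)
        (cN.left.rTensor A Y) := by
  induction X with
  | zero => simp
  | add _ _ h h' => simp only [map_add, LinearMap.add_apply, h, h']
  | tmul a m =>
    induction Y with
    | zero => simp
    | add _ _ h h' => simp only [map_add, h, h']
    | tmul b n => simp [rightPair, leftCoaction_mk]

theorem assoc_pair (X : (A ⊗[ℂ] M) ⊗[ℂ] A) (Y : (A ⊗[ℂ] N) ⊗[ℂ] A) :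
    TensorProduct.assoc ℂ A _ A (map₂ (leftPair A M N) (LinearMap.mul ℂ A) X Y) =
      map₂ (LinearMap.mul ℂ A) (rightPair A M N) (TensorProduct.assoc ℂ A M A X)
        (TensorProduct.assoc ℂ A N A Y) := by
  induction X with
  | zero => simp
  | add _ _ h h' => simp only [map_add, LinearMap.add_apply, h, h']
  | tmul X a =>
    induction Y with
    | zero => simp
    | add _ _ h h' => simp only [map_add, h, h']
    | tmul Y b =>
      induction X with
      | zero => simp
      | add _ _ h h' => simp only [map_add, add_tmul, LinearMap.add_apply, h, h']
      | tmul c m =>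
        induction Y with
        | zero => simp
        | add _ _ h h' => simp only [map_add, add_tmul, h, h']
        | tmul d n => simp [leftPair, rightPair]

theorem counit_leftPair (X : A ⊗[ℂ] M) (Y : A ⊗[ℂ] N) :
    TensorProduct.lid ℂ _ (counit.rTensor _ (leftPair A M N X Y)) =
      mk A M N (TensorProduct.lid ℂ M (counit.rTensor M X))
        (TensorProduct.lid ℂ N (counit.rTensor N Y)) := by
  induction X with
  | zero => simp
  | add _ _ h h' => simp only [map_add, LinearMap.add_apply, h, h']
  | tmul a m =>
    induction Y with
    | zero => simp
    | add _ _ h h' => simp only [map_add, h, h']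
    | tmul b n => simp [leftPair, smul_smul, mul_comm]

theorem counit_rightPair (X : M ⊗[ℂ] A) (Y : N ⊗[ℂ] A) :
    TensorProduct.rid ℂ _ (counit.lTensor _ (rightPair A M N X Y)) =
      mk A M N (TensorProduct.rid ℂ M (counit.lTensor M X))
        (TensorProduct.rid ℂ N (counit.lTensor N Y)) := by
  induction X with
  | zero => simp
  | add _ _ h h' => simp only [map_add, LinearMap.add_apply, h, h']
  | tmul a m =>
    induction Y with
    | zero => simp
    | add _ _ h h' => simp only [map_add, h, h']
    | tmul b n => simp [rightPair, smul_smul, mul_comm]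

end BTensor

open BTensor in
/-- The tensor product `M ⊗_A N` of bicovariant bimodules. -/
def Bicovariant.tensor (cM : Bicovariant A M) (cN : Bicovariant A N) :
    Bicovariant A (BTensor A M N) where
  left := leftCoaction cM cN
  right := rightCoaction cM cN
  left_coassoc t := by
    induction t using BTensor.induction_on with
    | zero => simp
    | add s t hs ht => simp only [map_add, hs, ht]
    | tmul m n =>
      rw [leftCoaction_mk, comul_leftPair, leftCoaction_leftPair, cM.left_coassoc,
        cN.left_coassoc]
  left_counit t := by
    induction t using BTensor.induction_on with
    | zero => simp
    | add s t hs ht => simp only [map_add, hs, ht]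
    | tmul m n => rw [leftCoaction_mk, counit_leftPair, cM.left_counit, cN.left_counit]
  right_coassoc t := by
    induction t using BTensor.induction_on with
    | zero => simp
    | add s t hs ht => simp only [map_add, hs, ht]
    | tmul m n =>
      rw [← LinearEquiv.eq_symm_apply, rightCoaction_mk, comul_rightPair,
        rightCoaction_rightPair, ← cM.right_coassoc, ← cN.right_coassoc,
        LinearEquiv.symm_apply_apply, LinearEquiv.symm_apply_apply]
  right_counit t := by
    induction t using BTensor.induction_on with
    | zero => simp
    | add s t hs ht => simp only [map_add, hs, ht]
    | tmul m n => rw [rightCoaction_mk, counit_rightPair, cM.right_counit, cN.right_counit]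
  left_smul a t := by
    induction t using BTensor.induction_on with
    | zero => simp
    | add s t hs ht => simp only [map_add, smul_add, hs, ht]
    | tmul m n => rw [smul_mk, leftCoaction_mk, leftCoaction_mk, cM.left_smul, leftPair_smul]
  left_op_smul a t := by
    induction t using BTensor.induction_on with
    | zero => simp
    | add s t hs ht => simp only [map_add, smul_add, LinearMap.add_apply, hs, ht]
    | tmul m n =>
      rw [op_smul_mk, leftCoaction_mk, leftCoaction_mk, cN.left_op_smul, leftPair_op_smul]
  right_smul a t := by
    induction t using BTensor.induction_on with
    | zero => simp
    | add s t hs ht => simp only [map_add, smul_add, hs, ht]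
    | tmul m n =>
      rw [smul_mk, rightCoaction_mk, rightCoaction_mk, cM.right_smul, rightPair_smul]
  right_op_smul a t := by
    induction t using BTensor.induction_on with
    | zero => simp
    | add s t hs ht => simp only [map_add, smul_add, LinearMap.add_apply, hs, ht]
    | tmul m n =>
      rw [op_smul_mk, rightCoaction_mk, rightCoaction_mk, cN.right_op_smul, rightPair_op_smul]
  left_right_comm t := by
    induction t using BTensor.induction_on with
    | zero => simp
    | add s t hs ht => simp only [map_add, hs, ht]
    | tmul m n =>
      rw [leftCoaction_mk, rightCoaction_mk, rightCoaction_leftPair, leftCoaction_rightPair,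
        assoc_pair, cM.left_right_comm, cN.left_right_comm]

end Coactions

section Braiding

open Coalgebra TensorProduct HopfAlgebra

variable {A : Type*} [Ring A] [HopfAlgebra ℂ A]
  {M : Type*} [AddCommGroup M] [Module ℂ M] [Module A M] [Module Aᵐᵒᵖ M]
  [IsScalarTower ℂ A M] [IsScalarTower ℂ Aᵐᵒᵖ M] [SMulCommClass A Aᵐᵒᵖ M]

namespace Bicovariant

/-- `₀M`, the left-invariant elements. -/
def leftInvariant (cM : Bicovariant A M) : Submodule ℂ M :=
  LinearMap.eqLocus cM.left (TensorProduct.mk ℂ A M 1)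

/-- `M₀`, the right-invariant elements. -/
def rightInvariant (cM : Bicovariant A M) : Submodule ℂ M :=
  LinearMap.eqLocus cM.right ((TensorProduct.mk ℂ M A).flip 1)

theorem mem_leftInvariant (cM : Bicovariant A M) (m : M) :
    m ∈ cM.leftInvariant ↔ cM.left m = 1 ⊗ₜ[ℂ] m := Iff.rfl

theorem mem_rightInvariant (cM : Bicovariant A M) (m : M) :
    m ∈ cM.rightInvariant ↔ cM.right m = m ⊗ₜ[ℂ] 1 := Iff.rfl

/-- `m ↦ S(m₍₋₁₎) m₍₀₎`. -/
def leftProj (cM : Bicovariant A M) : M →ₗ[ℂ] M :=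
  TensorProduct.lift ((lact A M).comp (antipode ℂ)) ∘ₗ cM.left

/-- `m ↦ m₍₀₎ S(m₍₁₎)`. -/
def rightProj (cM : Bicovariant A M) : M →ₗ[ℂ] M :=
  TensorProduct.lift ((ract A M).compl₂ (antipode ℂ)) ∘ₗ cM.right

/-- `m ↦ m₍₋₂₎ ⊗ S(m₍₋₁₎) m₍₀₎`. -/
def leftSplit (cM : Bicovariant A M) : M →ₗ[ℂ] A ⊗[ℂ] M :=
  cM.leftProj.lTensor A ∘ₗ cM.left

/-- `m ↦ m₍₀₎ S(m₍₁₎) ⊗ m₍₂₎`. -/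
def rightSplit (cM : Bicovariant A M) : M →ₗ[ℂ] M ⊗[ℂ] A :=
  cM.rightProj.rTensor A ∘ₗ cM.right

end Bicovariant

variable (A M) in
/-- `(a ⊗ m, n ⊗ b) ↦ a n ⊗ m b`. -/
def braidPair : A ⊗[ℂ] M →ₗ[ℂ] M ⊗[ℂ] A →ₗ[ℂ] BTensor A M M :=
  TensorProduct.lift (LinearMap.mk₂ ℂ
    (fun a m => TensorProduct.lift ((BTensor.mk A M M).compl₁₂ (lact A M a) (ract A M m)))
    (fun _ _ _ => TensorProduct.ext' fun _ _ => by simp)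
    (fun _ _ _ => TensorProduct.ext' fun _ _ => by simp)
    (fun _ _ _ => TensorProduct.ext' fun _ _ => by simp)
    (fun _ _ _ => TensorProduct.ext' fun _ _ => by simp))

@[simp] theorem braidPair_tmul (a b : A) (m n : M) :
    braidPair A M (a ⊗ₜ m) (n ⊗ₜ b) = BTensor.mk A M M (a • n) (op b • m) := rfl

variable (A M) in
/-- `(c ⊗ d, m) ↦ S(c) m d`. -/
def adRight : A ⊗[ℂ] A →ₗ[ℂ] M →ₗ[ℂ] M :=
  TensorProduct.lift (LinearMap.mk₂ ℂ
    (fun c d => (ract A M).flip d ∘ₗ lact A M (antipode ℂ c))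
    (fun _ _ _ => LinearMap.ext fun _ => by simp)
    (fun _ _ _ => LinearMap.ext fun _ => by simp)
    (fun _ _ _ => LinearMap.ext fun _ => by simp)
    (fun _ _ _ => LinearMap.ext fun _ => by simp))

variable (A M) in
/-- `(c ⊗ d, m) ↦ c m S(d)`. -/
def adLeft : A ⊗[ℂ] A →ₗ[ℂ] M →ₗ[ℂ] M :=
  TensorProduct.lift (LinearMap.mk₂ ℂ
    (fun c d => (ract A M).flip (antipode ℂ d) ∘ₗ lact A M c)
    (fun _ _ _ => LinearMap.ext fun _ => by simp)
    (fun _ _ _ => LinearMap.ext fun _ => by simp)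
    (fun _ _ _ => LinearMap.ext fun _ => by simp)
    (fun _ _ _ => LinearMap.ext fun _ => by simp))

theorem adRight_tmul (c d : A) (m : M) :
    adRight A M (c ⊗ₜ d) m = op d • antipode ℂ c • m := rfl

theorem adLeft_tmul (c d : A) (m : M) :
    adLeft A M (c ⊗ₜ d) m = op (antipode ℂ d) • c • m := rfl

namespace Bicovariant

variable (cM : Bicovariant A M)

theorem leftProj_op_smul (b : A) (m : M) :
    cM.leftProj (op b • m) = adRight A M (comul b) (cM.leftProj m) := by
  simp only [leftProj, LinearMap.comp_apply, cM.left_op_smul]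
  generalize cM.left m = X
  generalize (comul b : A ⊗[ℂ] A) = D
  induction X with
  | zero => simp
  | add _ _ h h' => simp only [map_add, LinearMap.add_apply, h, h']
  | tmul x y =>
    induction D with
    | zero => simp
    | add _ _ h h' => simp only [map_add, LinearMap.add_apply, h, h']
    | tmul c d => simp [adRight_tmul, antipode_mul_antidistrib, mul_smul, smul_comm (_ : A) (op d)]

theorem rightProj_smul (b : A) (m : M) :
    cM.rightProj (b • m) = adLeft A M (comul b) (cM.rightProj m) := by
  simp only [rightProj, LinearMap.comp_apply, cM.right_smul]
  generalize cM.right m = X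
  generalize (comul b : A ⊗[ℂ] A) = D
  induction X with
  | zero => simp
  | add _ _ h h' => simp only [map_add, h, h']
  | tmul x y =>
    induction D with
    | zero => simp
    | add _ _ h h' => simp only [map_add, LinearMap.add_apply, h, h']
    | tmul c d => simp [adLeft_tmul, antipode_mul_antidistrib, mul_smul, smul_comm c]

theorem leftProj_smul (b : A) (m : M) :
    cM.leftProj (b • m) = counit (R := ℂ) b • cM.leftProj m := by
  have key : ∀ (D : A ⊗[ℂ] A) (X : A ⊗[ℂ] M),
      TensorProduct.lift ((lact A M).comp (antipode ℂ))
        (map₂ (LinearMap.mul ℂ A) (lact A M) D X) =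
      TensorProduct.lift (LinearMap.mk₂ ℂ (fun x y => antipode ℂ x •
        LinearMap.mul' ℂ A ((antipode ℂ).rTensor A D) • y)
        (by simp [add_smul]) (by simp) (by simp) (fun k _ _ => by simp only [smul_comm (_ : A) k])) X := by
    intro D X
    induction X with
    | zero => simp
    | add _ _ h h' => simp only [map_add, h, h']
    | tmul x y =>
      induction D with
      | zero => simp
      | add _ _ h h' =>
        simp only [map_add, LinearMap.add_apply, h, h']
        simp [add_smul]
      | tmul c d => simp [antipode_mul_antidistrib, mul_smul]
  simp only [leftProj, LinearMap.comp_apply, cM.left_smul, key,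
    mul_antipode_rTensor_comul_apply]
  generalize cM.left m = X
  induction X with
  | zero => simp
  | add _ _ h h' => simp only [map_add, smul_add, h, h']
  | tmul x y =>
    simp only [lift.tmul, LinearMap.mk₂_apply, LinearMap.comp_apply, lact_apply,
      algebraMap_smul]
    rw [smul_comm]

theorem rightProj_op_smul (b : A) (m : M) :
    cM.rightProj (op b • m) = counit (R := ℂ) b • cM.rightProj m := by
  have key : ∀ (D : A ⊗[ℂ] A) (X : M ⊗[ℂ] A),
      TensorProduct.lift ((ract A M).compl₂ (antipode ℂ))
        (map₂ (ract A M) (LinearMap.mul ℂ A) X D) =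
      TensorProduct.lift (LinearMap.mk₂ ℂ (fun y x => op (antipode ℂ x) •
        op (LinearMap.mul' ℂ A ((antipode ℂ).lTensor A D)) • y)
        (by simp) (fun k _ _ => by simp only [smul_comm (_ : Aᵐᵒᵖ) k]) (by simp [add_smul])
        (by simp)) X := by
    intro D X
    induction X with
    | zero => simp
    | add _ _ h h' => simp only [map_add, LinearMap.add_apply, h, h']
    | tmul y x =>
      induction D with
      | zero => simp
      | add _ _ h h' =>
        simp only [map_add, h, h']
        simp [add_smul]
      | tmul c d => simp [antipode_mul_antidistrib, mul_smul]
  simp only [rightProj, LinearMap.comp_apply, cM.right_op_smul, key,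
    mul_antipode_lTensor_comul_apply]
  generalize cM.right m = X
  induction X with
  | zero => simp
  | add _ _ h h' => simp only [map_add, smul_add, h, h']
  | tmul y x =>
    simp only [lift.tmul, LinearMap.mk₂_apply, LinearMap.compl₂_apply, ract_apply,
      ← MulOpposite.algebraMap_apply, algebraMap_smul]
    rw [smul_comm]

theorem leftSplit_op_smul (b : A) (m : M) :
    cM.leftSplit (op b • m) = map₂ (LinearMap.mul ℂ A) (adRight A M).flip (cM.leftSplit m)
      (comul.lTensor A (comul b)) := by
  simp only [leftSplit, LinearMap.comp_apply, cM.left_op_smul]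
  generalize cM.left m = X
  generalize (comul b : A ⊗[ℂ] A) = D
  induction X with
  | zero => simp
  | add _ _ h h' => simp only [map_add, LinearMap.add_apply, h, h']
  | tmul x y =>
    induction D with
    | zero => simp
    | add _ _ h h' => simp only [map_add, h, h']
    | tmul c d => simp [leftProj_op_smul]

theorem rightSplit_smul (b : A) (m : M) :
    cM.rightSplit (b • m) = map₂ (adLeft A M) (LinearMap.mul ℂ A)
      (comul.rTensor A (comul b)) (cM.rightSplit m) := by
  simp only [rightSplit, LinearMap.comp_apply, cM.right_smul]
  generalize cM.right m = X
  generalize (comul b : A ⊗[ℂ] A) = D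
  induction X with
  | zero => simp
  | add _ _ h h' => simp only [map_add, h, h']
  | tmul x y =>
    induction D with
    | zero => simp
    | add _ _ h h' => simp only [map_add, LinearMap.add_apply, h, h']
    | tmul c d => simp [rightProj_smul]

theorem leftSplit_smul (b : A) (m : M) :
    cM.leftSplit (b • m) = (LinearMap.mul ℂ A b).rTensor M (cM.leftSplit m) := by
  have key : ∀ (D : A ⊗[ℂ] A) (X : A ⊗[ℂ] M),
      cM.leftProj.lTensor A (map₂ (LinearMap.mul ℂ A) (lact A M) D X) =
      (LinearMap.mul ℂ A (TensorProduct.rid ℂ A (counit.lTensor A D))).rTensor M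
        (cM.leftProj.lTensor A X) := by
    intro D X
    induction X with
    | zero => simp
    | add _ _ h h' => simp only [map_add, h, h']
    | tmul x y =>
      induction D with
      | zero => simp
      | add _ _ h h' =>
        simp only [map_add, LinearMap.add_apply, h, h', LinearMap.rTensor_add]
      | tmul c d => simp [leftProj_smul, smul_tmul']
  simp only [leftSplit, LinearMap.comp_apply, cM.left_smul, key]
  simp

theorem rightSplit_op_smul (b : A) (m : M) :
    cM.rightSplit (op b • m) = ((LinearMap.mul ℂ A).flip b).lTensor M (cM.rightSplit m) := by
  have key : ∀ (D : A ⊗[ℂ] A) (X : M ⊗[ℂ] A),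
      cM.rightProj.rTensor A (map₂ (ract A M) (LinearMap.mul ℂ A) X D) =
      ((LinearMap.mul ℂ A).flip (TensorProduct.lid ℂ A (counit.rTensor A D))).lTensor M
        (cM.rightProj.rTensor A X) := by
    intro D X
    induction X with
    | zero => simp
    | add _ _ h h' => simp only [map_add, LinearMap.add_apply, h, h']
    | tmul x y =>
      induction D with
      | zero => simp
      | add _ _ h h' =>
        simp only [map_add, LinearMap.add_apply, h, h', LinearMap.lTensor_add]
      | tmul c d => simp [rightProj_op_smul, smul_tmul']
  simp only [rightSplit, LinearMap.comp_apply, cM.right_op_smul, key]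
  simp

theorem braidPair_balanced (X : A ⊗[ℂ] M) (D : A ⊗[ℂ] (A ⊗[ℂ] A)) (Y : M ⊗[ℂ] A) :
    braidPair A M (map₂ (LinearMap.mul ℂ A) (adRight A M).flip X D) Y =
      braidPair A M X (map₂ (adLeft A M) (LinearMap.mul ℂ A)
        ((TensorProduct.assoc ℂ A A A).symm D) Y) := by
  induction X with
  | zero => simp
  | add _ _ h h' => simp only [map_add, LinearMap.add_apply, h, h']
  | tmul x y =>
    induction Y with
    | zero => simp
    | add _ _ h h' => simp only [map_add, h, h']
    | tmul z w =>
      induction D with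
      | zero => simp
      | add _ _ h h' => simp only [map_add, LinearMap.add_apply, h, h']
      | tmul c D =>
        induction D with
        | zero => simp
        | add _ _ h h' => simp only [map_add, LinearMap.add_apply, tmul_add, h, h']
        | tmul d e =>
          simp only [map₂_apply_tmul, TensorProduct.map_tmul, TensorProduct.assoc_symm_tmul,
            LinearMap.flip_apply, LinearMap.mul_apply', adRight_tmul, adLeft_tmul,
            braidPair_tmul]
          rw [smul_comm x, BTensor.mk_balanced]
          simp [mul_smul, smul_comm (antipode ℂ d)]

/-- Woronowicz's braiding `σ : M ⊗_A M → M ⊗_A M`, given by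
`σ(m ⊗ n) = m₍₋₂₎ n₍₀₎ S(n₍₁₎) ⊗ S(m₍₋₁₎) m₍₀₎ n₍₂₎`. By `braiding_mk`, `braiding_smul`,
`braiding_op_smul` and `braiding_unique` below it is the unique bimodule map with
`σ(ω ⊗ η) = η ⊗ ω` for `ω` left-invariant and `η` right-invariant. -/
def braiding : BTensor A M M →ₗ[ℂ] BTensor A M M :=
  BTensor.lift ((braidPair A M).compl₁₂ cM.leftSplit cM.rightSplit) (fun m a n => by
    simp only [LinearMap.compl₁₂_apply, leftSplit_op_smul, rightSplit_smul,
      braidPair_balanced, coassoc_symm_apply])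

theorem braiding_apply (m n : M) :
    cM.braiding (BTensor.mk A M M m n) = braidPair A M (cM.leftSplit m) (cM.rightSplit n) := rfl

theorem leftSplit_of_mem {ω : M} (h : ω ∈ cM.leftInvariant) :
    cM.leftSplit ω = 1 ⊗ₜ[ℂ] ω := by
  rw [mem_leftInvariant] at h
  simp [leftSplit, leftProj, h, antipode_one]

theorem rightSplit_of_mem {η : M} (h : η ∈ cM.rightInvariant) :
    cM.rightSplit η = η ⊗ₜ[ℂ] 1 := by
  rw [mem_rightInvariant] at h
  simp [rightSplit, rightProj, h, antipode_one]

theorem braiding_mk {ω η : M} (hω : ω ∈ cM.leftInvariant) (hη : η ∈ cM.rightInvariant) :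
    cM.braiding (BTensor.mk A M M ω η) = BTensor.mk A M M η ω := by
  simp [braiding_apply, leftSplit_of_mem cM hω, rightSplit_of_mem cM hη]

theorem braiding_smul (a : A) (t : BTensor A M M) :
    cM.braiding (a • t) = a • cM.braiding t := by
  induction t using BTensor.induction_on with
  | zero => simp
  | add s t hs ht => simp only [map_add, smul_add, hs, ht]
  | tmul m n =>
    rw [BTensor.smul_mk, braiding_apply, braiding_apply, leftSplit_smul]
    generalize cM.leftSplit m = X
    generalize cM.rightSplit n = Y
    induction X with
    | zero => simp
    | add _ _ h h' => simp only [map_add, LinearMap.add_apply, smul_add, h, h']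
    | tmul x y =>
      induction Y with
      | zero => simp
      | add _ _ h h' => simp only [map_add, smul_add, h, h']
      | tmul z w => simp [mul_smul]

theorem braiding_op_smul (a : A) (t : BTensor A M M) :
    cM.braiding (op a • t) = op a • cM.braiding t := by
  induction t using BTensor.induction_on with
  | zero => simp
  | add s t hs ht => simp only [map_add, smul_add, hs, ht]
  | tmul m n =>
    rw [BTensor.op_smul_mk, braiding_apply, braiding_apply, rightSplit_op_smul]
    generalize cM.leftSplit m = X
    generalize cM.rightSplit n = Y
    induction X with
    | zero => simp
    | add _ _ h h' => simp only [map_add, LinearMap.add_apply, smul_add, h, h']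
    | tmul x y =>
      induction Y with
      | zero => simp
      | add _ _ h h' => simp only [map_add, smul_add, h, h']
      | tmul z w => simp [mul_smul]

theorem lift_leftSplit (m : M) : TensorProduct.lift (lact A M) (cM.leftSplit m) = m := by
  have key : ∀ X : A ⊗[ℂ] M, TensorProduct.lift (lact A M) (cM.leftProj.lTensor A X) =
      TensorProduct.lift ((lact A M).comp (LinearMap.mul' ℂ A)) ((TensorProduct.map
        ((antipode ℂ).lTensor A) LinearMap.id) ((TensorProduct.assoc ℂ A A M).symm
          (cM.left.lTensor A X))) := by
    intro X
    induction X with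
    | zero => simp
    | add _ _ h h' => simp only [map_add, h, h']
    | tmul x y =>
      simp only [LinearMap.lTensor_tmul, lift.tmul, lact_apply, leftProj, LinearMap.comp_apply]
      generalize cM.left y = Y
      induction Y with
      | zero => simp
      | add _ _ h h' => simp only [map_add, tmul_add, smul_add, h, h']
      | tmul z w => simp [mul_smul]
  rw [leftSplit, LinearMap.comp_apply, key, ← cM.left_coassoc, LinearEquiv.symm_apply_apply]
  conv_rhs => rw [← cM.left_counit m]
  generalize cM.left m = X
  induction X with
  | zero => simp
  | add _ _ h h' => simp only [map_add, h, h']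
  | tmul x y =>
    simp only [LinearMap.rTensor_tmul, TensorProduct.map_tmul, lift.tmul, LinearMap.comp_apply,
      mul_antipode_lTensor_comul_apply, lact_apply, algebraMap_smul, LinearMap.id_apply,
      TensorProduct.lid_tmul]

theorem lift_rightSplit (m : M) : TensorProduct.lift (ract A M) (cM.rightSplit m) = m := by
  have key : ∀ X : M ⊗[ℂ] A, TensorProduct.lift (ract A M) (cM.rightProj.rTensor A X) =
      TensorProduct.lift ((ract A M).compl₂ (LinearMap.mul' ℂ A)) ((TensorProduct.map
        LinearMap.id ((antipode ℂ).rTensor A)) (TensorProduct.assoc ℂ M A A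
          (cM.right.rTensor A X))) := by
    intro X
    induction X with
    | zero => simp
    | add _ _ h h' => simp only [map_add, h, h']
    | tmul y x =>
      simp only [LinearMap.rTensor_tmul, lift.tmul, ract_apply, rightProj, LinearMap.comp_apply]
      generalize cM.right y = Y
      induction Y with
      | zero => simp
      | add _ _ h h' => simp only [map_add, add_tmul, smul_add, h, h']
      | tmul w z => simp [mul_smul]
  rw [rightSplit, LinearMap.comp_apply, key, cM.right_coassoc]
  conv_rhs => rw [← cM.right_counit m]
  generalize cM.right m = X
  induction X with
  | zero => simp
  | add _ _ h h' => simp only [map_add, h, h']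
  | tmul y x =>
    simp only [LinearMap.lTensor_tmul, TensorProduct.map_tmul, lift.tmul,
      LinearMap.compl₂_apply, mul_antipode_rTensor_comul_apply, ract_apply, algebraMap_smul,
      ← MulOpposite.algebraMap_apply, LinearMap.id_apply, TensorProduct.rid_tmul]

end Bicovariant

end Braiding

section BraidingUnique

open Coalgebra TensorProduct HopfAlgebra

variable {A : Type*} [Ring A] [HopfAlgebra ℂ A]
  {M : Type*} [AddCommGroup M] [Module ℂ M] [Module A M] [Module Aᵐᵒᵖ M]
  [IsScalarTower ℂ A M] [IsScalarTower ℂ Aᵐᵒᵖ M] [SMulCommClass A Aᵐᵒᵖ M]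

theorem map₂_mul_lact (D D' : A ⊗[ℂ] A) (Z : A ⊗[ℂ] M) :
    map₂ (LinearMap.mul ℂ A) (lact A M) (D * D') Z = map₂ (LinearMap.mul ℂ A) (lact A M) D
      (map₂ (LinearMap.mul ℂ A) (lact A M) D' Z) := by
  induction Z with
  | zero => simp
  | add _ _ h h' => simp only [map_add, h, h']
  | tmul x y =>
    induction D with
    | zero => simp
    | add _ _ h h' => simp only [map_add, add_mul, LinearMap.add_apply, h, h']
    | tmul a b =>
      induction D' with
      | zero => simp
      | add _ _ h h' => simp only [map_add, mul_add, LinearMap.add_apply, h, h']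
      | tmul c d => simp [mul_assoc, mul_smul]

theorem map₂_ract_mul (D D' : A ⊗[ℂ] A) (Z : M ⊗[ℂ] A) :
    map₂ (ract A M) (LinearMap.mul ℂ A) Z (D * D') = map₂ (ract A M) (LinearMap.mul ℂ A)
      (map₂ (ract A M) (LinearMap.mul ℂ A) Z D) D' := by
  induction Z with
  | zero => simp
  | add _ _ h h' => simp only [map_add, LinearMap.add_apply, h, h']
  | tmul x y =>
    induction D with
    | zero => simp
    | add _ _ h h' => simp only [map_add, add_mul, LinearMap.add_apply, h, h']
    | tmul a b =>
      induction D' with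
      | zero => simp
      | add _ _ h h' => simp only [map_add, mul_add, h, h']
      | tmul c d => simp [mul_assoc, mul_smul]

variable (A M) in
/-- `x ⊗ Z ↦ Δ(x) Z`. -/
def comulActLeft : A ⊗[ℂ] (A ⊗[ℂ] M) →ₗ[ℂ] A ⊗[ℂ] M :=
  TensorProduct.lift ((map₂ (LinearMap.mul ℂ A) (lact A M)).comp comul)

variable (A M) in
/-- `Z ⊗ x ↦ Z Δ(x)`. -/
def comulActRight : (M ⊗[ℂ] A) ⊗[ℂ] A →ₗ[ℂ] M ⊗[ℂ] A :=
  TensorProduct.lift ((map₂ (ract A M) (LinearMap.mul ℂ A)).compl₂ comul)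

namespace Bicovariant

variable (cM : Bicovariant A M)

theorem eq_zero_of_comulActLeft (H : M →ₗ[ℂ] A ⊗[ℂ] M)
    (hH : ∀ m, comulActLeft A M (H.lTensor A (cM.left m)) = 0) (m : M) : H m = 0 := by
  have key : ∀ W : A ⊗[ℂ] (A ⊗[ℂ] M),
      TensorProduct.lift ((map₂ (LinearMap.mul ℂ A) (lact A M)).comp
          (comul ∘ₗ antipode ℂ)) ((comulActLeft A M ∘ₗ H.lTensor A).lTensor A W) =
        comulActLeft A M (TensorProduct.map (LinearMap.mul' ℂ A ∘ₗ (antipode ℂ).rTensor A) H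
          ((TensorProduct.assoc ℂ A A M).symm W)) := by
    intro W
    induction W with
    | zero => simp
    | add _ _ h h' => simp only [map_add, h, h']
    | tmul x W =>
      induction W with
      | zero => simp
      | add _ _ h h' => simp only [map_add, tmul_add, h, h']
      | tmul y z => simp [comulActLeft, map₂_mul_lact]
  have h1 := key (cM.left.lTensor A (cM.left m))
  rw [← LinearMap.lTensor_comp_apply,
    show (comulActLeft A M ∘ₗ H.lTensor A) ∘ₗ cM.left = 0 from LinearMap.ext hH,
    ← cM.left_coassoc, LinearEquiv.symm_apply_apply] at h1
  have h2 : ∀ X : A ⊗[ℂ] M, comulActLeft A M (TensorProduct.map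
      (LinearMap.mul' ℂ A ∘ₗ (antipode ℂ).rTensor A) H (comul.rTensor M X)) =
        H (TensorProduct.lid ℂ M (counit.rTensor M X)) := by
    intro X
    induction X with
    | zero => simp
    | add _ _ h h' => simp only [map_add, h, h']
    | tmul x y =>
      simp only [LinearMap.rTensor_tmul, TensorProduct.map_tmul, LinearMap.comp_apply,
        mul_antipode_rTensor_comul_apply, comulActLeft, lift.tmul,
        Bialgebra.comul_algebraMap, TensorProduct.lid_tmul, map_smul]
      generalize H y = Z
      rw [Algebra.algebraMap_eq_smul_one, map_smul, LinearMap.smul_apply,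
        Algebra.TensorProduct.one_def]
      congr 1
      induction Z with
      | zero => simp
      | add _ _ h h' => simp only [map_add, h, h']
      | tmul p q => simp
  rw [h2, cM.left_counit] at h1
  simpa using h1.symm

theorem eq_zero_of_comulActRight (H : M →ₗ[ℂ] M ⊗[ℂ] A)
    (hH : ∀ m, comulActRight A M (H.rTensor A (cM.right m)) = 0) (m : M) : H m = 0 := by
  have key : ∀ W : (M ⊗[ℂ] A) ⊗[ℂ] A,
      TensorProduct.lift ((map₂ (ract A M) (LinearMap.mul ℂ A)).compl₂
          (comul ∘ₗ antipode ℂ)) ((comulActRight A M ∘ₗ H.rTensor A).rTensor A W) =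
        comulActRight A M (TensorProduct.map H (LinearMap.mul' ℂ A ∘ₗ (antipode ℂ).lTensor A)
          (TensorProduct.assoc ℂ M A A W)) := by
    intro W
    induction W with
    | zero => simp
    | add _ _ h h' => simp only [map_add, h, h']
    | tmul W x =>
      induction W with
      | zero => simp
      | add _ _ h h' => simp only [map_add, add_tmul, h, h']
      | tmul y z => simp [comulActRight, map₂_ract_mul]
  have h1 := key (cM.right.rTensor A (cM.right m))
  rw [← LinearMap.rTensor_comp_apply,
    show (comulActRight A M ∘ₗ H.rTensor A) ∘ₗ cM.right = 0 from LinearMap.ext hH,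
    cM.right_coassoc] at h1
  have h2 : ∀ X : M ⊗[ℂ] A, comulActRight A M (TensorProduct.map H
      (LinearMap.mul' ℂ A ∘ₗ (antipode ℂ).lTensor A) (comul.lTensor M X)) =
        H (TensorProduct.rid ℂ M (counit.lTensor M X)) := by
    intro X
    induction X with
    | zero => simp
    | add _ _ h h' => simp only [map_add, h, h']
    | tmul x y =>
      simp only [LinearMap.lTensor_tmul, TensorProduct.map_tmul, LinearMap.comp_apply,
        mul_antipode_lTensor_comul_apply, comulActRight, lift.tmul, LinearMap.compl₂_apply,
        Bialgebra.comul_algebraMap, TensorProduct.rid_tmul, map_smul]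
      generalize H x = Z
      rw [Algebra.algebraMap_eq_smul_one, map_smul, Algebra.TensorProduct.one_def]
      congr 1
      induction Z with
      | zero => simp
      | add _ _ h h' => simp only [map_add, LinearMap.add_apply, h, h']
      | tmul p q => simp
  rw [h2, cM.right_counit] at h1
  simpa using h1.symm

theorem leftProj_mem (m : M) : cM.leftProj m ∈ cM.leftInvariant := by
  rw [mem_leftInvariant, ← sub_eq_zero]
  refine cM.eq_zero_of_comulActLeft
    (cM.left ∘ₗ cM.leftProj - TensorProduct.mk ℂ A M 1 ∘ₗ cM.leftProj) (fun n => ?_) m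
  rw [LinearMap.lTensor_sub, LinearMap.sub_apply, map_sub, sub_eq_zero]
  have h1 : ∀ X : A ⊗[ℂ] M, comulActLeft A M ((cM.left ∘ₗ cM.leftProj).lTensor A X) =
      cM.left (TensorProduct.lift (lact A M) (cM.leftProj.lTensor A X)) := by
    intro X
    induction X with
    | zero => simp
    | add _ _ h h' => simp only [map_add, h, h']
    | tmul x y => simp [comulActLeft, cM.left_smul]
  have h2 : ∀ X : A ⊗[ℂ] M,
      comulActLeft A M ((TensorProduct.mk ℂ A M 1 ∘ₗ cM.leftProj).lTensor A X) =
      (TensorProduct.lift (lact A M) ∘ₗ cM.leftProj.lTensor A).lTensor A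
        (TensorProduct.assoc ℂ A A M (comul.rTensor M X)) := by
    intro X
    induction X with
    | zero => simp
    | add _ _ h h' => simp only [map_add, h, h']
    | tmul x y =>
      simp only [comulActLeft, LinearMap.lTensor_tmul, LinearMap.rTensor_tmul, lift.tmul,
        LinearMap.comp_apply]
      generalize (comul x : A ⊗[ℂ] A) = D
      induction D with
      | zero => simp
      | add _ _ h h' => simp only [map_add, add_tmul, LinearMap.add_apply, h, h']
      | tmul c d => simp
  have h3 := cM.lift_leftSplit
  simp only [leftSplit, LinearMap.comp_apply] at h3
  rw [h1, h2, h3, cM.left_coassoc, ← LinearMap.lTensor_comp_apply,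
    show (TensorProduct.lift (lact A M) ∘ₗ cM.leftProj.lTensor A) ∘ₗ cM.left = LinearMap.id
      from LinearMap.ext h3]
  simp

theorem rightProj_mem (m : M) : cM.rightProj m ∈ cM.rightInvariant := by
  rw [mem_rightInvariant, ← sub_eq_zero]
  refine cM.eq_zero_of_comulActRight
    (cM.right ∘ₗ cM.rightProj - (TensorProduct.mk ℂ M A).flip 1 ∘ₗ cM.rightProj)
    (fun n => ?_) m
  rw [LinearMap.rTensor_sub, LinearMap.sub_apply, map_sub, sub_eq_zero]
  have h1 : ∀ X : M ⊗[ℂ] A, comulActRight A M ((cM.right ∘ₗ cM.rightProj).rTensor A X) =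
      cM.right (TensorProduct.lift (ract A M) (cM.rightProj.rTensor A X)) := by
    intro X
    induction X with
    | zero => simp
    | add _ _ h h' => simp only [map_add, h, h']
    | tmul x y => simp [comulActRight, cM.right_op_smul]
  have h2 : ∀ X : M ⊗[ℂ] A, comulActRight A M
      (((TensorProduct.mk ℂ M A).flip 1 ∘ₗ cM.rightProj).rTensor A X) =
      (TensorProduct.lift (ract A M) ∘ₗ cM.rightProj.rTensor A).rTensor A
        ((TensorProduct.assoc ℂ M A A).symm (comul.lTensor M X)) := by
    intro X
    induction X with
    | zero => simp
    | add _ _ h h' => simp only [map_add, h, h']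
    | tmul y x =>
      simp only [comulActRight, LinearMap.lTensor_tmul, LinearMap.rTensor_tmul, lift.tmul,
        LinearMap.comp_apply, LinearMap.compl₂_apply]
      generalize (comul x : A ⊗[ℂ] A) = D
      induction D with
      | zero => simp
      | add _ _ h h' => simp only [map_add, tmul_add, h, h']
      | tmul c d => simp
  have h3 := cM.lift_rightSplit
  simp only [rightSplit, LinearMap.comp_apply] at h3
  rw [h1, h2, h3, ← cM.right_coassoc, LinearEquiv.symm_apply_apply,
    ← LinearMap.rTensor_comp_apply,
    show (TensorProduct.lift (ract A M) ∘ₗ cM.rightProj.rTensor A) ∘ₗ cM.right = LinearMap.id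
      from LinearMap.ext h3]
  simp

theorem braiding_unique (τ : BTensor A M M →ₗ[ℂ] BTensor A M M)
    (hl : ∀ (a : A) t, τ (a • t) = a • τ t) (hr : ∀ (a : A) t, τ (op a • t) = op a • τ t)
    (hτ : ∀ ω ∈ cM.leftInvariant, ∀ η ∈ cM.rightInvariant,
      τ (BTensor.mk A M M ω η) = BTensor.mk A M M η ω) : τ = cM.braiding := by
  have key : ∀ (X : A ⊗[ℂ] M) (Y : M ⊗[ℂ] A),
      τ (BTensor.mk A M M (TensorProduct.lift (lact A M) (cM.leftProj.lTensor A X))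
        (TensorProduct.lift (ract A M) (cM.rightProj.rTensor A Y))) =
      braidPair A M (cM.leftProj.lTensor A X) (cM.rightProj.rTensor A Y) := by
    intro X Y
    induction X with
    | zero => simp
    | add _ _ h h' => simp only [map_add, LinearMap.add_apply, h, h']
    | tmul x y =>
      induction Y with
      | zero => simp
      | add _ _ h h' => simp only [map_add, h, h']
      | tmul z w =>
        simp only [LinearMap.lTensor_tmul, LinearMap.rTensor_tmul, lift.tmul, lact_apply,
          ract_apply, braidPair_tmul]
        rw [← BTensor.smul_mk, ← BTensor.op_smul_mk, hl, hr,
          hτ _ (cM.leftProj_mem y) _ (cM.rightProj_mem z), BTensor.op_smul_mk, BTensor.smul_mk]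
  refine LinearMap.ext fun t => ?_
  induction t using BTensor.induction_on with
  | zero => simp
  | add s t hs ht => simp only [map_add, hs, ht]
  | tmul m n =>
    have h := key (cM.left m) (cM.right n)
    have h3 := cM.lift_leftSplit m
    have h4 := cM.lift_rightSplit n
    simp only [leftSplit, rightSplit, LinearMap.comp_apply] at h3 h4
    rw [h3, h4] at h
    rw [h, braiding_apply]
    rfl

end Bicovariant

end BraidingUnique

section Category

open Coalgebra TensorProduct

variable {A : Type*} [Ring A] [HopfAlgebra ℂ A]
  {M : Type*} [AddCommGroup M] [Module ℂ M] [Module A M] [Module Aᵐᵒᵖ M]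
  [IsScalarTower ℂ A M] [IsScalarTower ℂ Aᵐᵒᵖ M] [SMulCommClass A Aᵐᵒᵖ M]
  {N : Type*} [AddCommGroup N] [Module ℂ N] [Module A N] [Module Aᵐᵒᵖ N]
  [IsScalarTower ℂ A N] [IsScalarTower ℂ Aᵐᵒᵖ N] [SMulCommClass A Aᵐᵒᵖ N]
  {P : Type*} [AddCommGroup P] [Module ℂ P] [Module A P] [Module Aᵐᵒᵖ P]
  [IsScalarTower ℂ A P] [IsScalarTower ℂ Aᵐᵒᵖ P] [SMulCommClass A Aᵐᵒᵖ P]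
  {Q : Type*} [AddCommGroup Q] [Module ℂ Q] [Module A Q] [Module Aᵐᵒᵖ Q]
  [IsScalarTower ℂ A Q] [IsScalarTower ℂ Aᵐᵒᵖ Q] [SMulCommClass A Aᵐᵒᵖ Q]

/-- A morphism in the category of bicovariant bimodules: a bimodule map that is left and right
covariant. -/
structure BicovariantHom (cM : Bicovariant A M) (cN : Bicovariant A N) extends M →ₗ[ℂ] N where
  map_smul_left : ∀ (a : A) (m : M), toLinearMap (a • m) = a • toLinearMap m
  map_smul_right : ∀ (a : A) (m : M), toLinearMap (op a • m) = op a • toLinearMap m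
  left_covariant : ∀ m, toLinearMap.lTensor A (cM.left m) = cN.left (toLinearMap m)
  right_covariant : ∀ m, toLinearMap.rTensor A (cM.right m) = cN.right (toLinearMap m)

instance (cM : Bicovariant A M) (cN : Bicovariant A N) :
    CoeFun (BicovariantHom cM cN) (fun _ => M → N) := ⟨fun f => f.toLinearMap⟩

/-- The identity morphism. -/
def BicovariantHom.id (cM : Bicovariant A M) : BicovariantHom cM cM where
  toLinearMap := LinearMap.id
  map_smul_left _ _ := rfl
  map_smul_right _ _ := rfl
  left_covariant m := by simp
  right_covariant m := by simp

/-- An isomorphism in the category of bicovariant bimodules. -/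
structure BicovariantIso (cM : Bicovariant A M) (cN : Bicovariant A N) where
  hom : BicovariantHom cM cN
  inv : BicovariantHom cN cM
  inv_hom : ∀ m, inv (hom m) = m
  hom_inv : ∀ n, hom (inv n) = n

namespace BTensor

/-- `f ⊗ g : M ⊗_A N → P ⊗_A Q`. -/
def map {cM : Bicovariant A M} {cN : Bicovariant A N} {cP : Bicovariant A P}
    {cQ : Bicovariant A Q} (f : BicovariantHom cM cP) (g : BicovariantHom cN cQ) :
    BTensor A M N →ₗ[ℂ] BTensor A P Q :=
  lift ((mk A P Q).compl₁₂ f.toLinearMap g.toLinearMap) (fun m a n => by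
    simp only [LinearMap.compl₁₂_apply, f.map_smul_right, g.map_smul_left, mk_balanced])

theorem map_mk {cM : Bicovariant A M} {cN : Bicovariant A N} {cP : Bicovariant A P}
    {cQ : Bicovariant A Q} (f : BicovariantHom cM cP) (g : BicovariantHom cN cQ) (m : M) (n : N) :
    map f g (mk A M N m n) = mk A P Q (f m) (g n) := rfl

variable (A M N P) in
/-- `(m ⊗ n) ⊗ p ↦ m ⊗ (n ⊗ p)`. -/
def assocHom : BTensor A (BTensor A M N) P →ₗ[ℂ] BTensor A M (BTensor A N P) :=
  lift (lift (LinearMap.mk₂ ℂ (fun m n => (mk A M (BTensor A N P) m).comp (mk A N P n))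
      (fun _ _ _ => LinearMap.ext fun _ => by simp)
      (fun _ _ _ => LinearMap.ext fun _ => by simp)
      (fun _ _ _ => LinearMap.ext fun _ => by simp)
      (fun _ _ _ => LinearMap.ext fun _ => by simp))
    (fun m a n => LinearMap.ext fun p => by simp [mk_balanced]))
  (fun t a p => by
    induction t using induction_on with
    | zero => simp
    | add s t hs ht => simp only [smul_add, map_add, LinearMap.add_apply, hs, ht]
    | tmul m n => simp [mk_balanced])

variable (A M N P) in
/-- `m ⊗ (n ⊗ p) ↦ (m ⊗ n) ⊗ p`. -/
def assocInv : BTensor A M (BTensor A N P) →ₗ[ℂ] BTensor A (BTensor A M N) P :=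
  lift (LinearMap.flip (lift (LinearMap.mk₂ ℂ
      (fun n p => ((mk A (BTensor A M N) P).flip p).comp ((mk A M N).flip n))
      (fun _ _ _ => LinearMap.ext fun _ => by simp)
      (fun _ _ _ => LinearMap.ext fun _ => by simp)
      (fun _ _ _ => LinearMap.ext fun _ => by simp)
      (fun _ _ _ => LinearMap.ext fun _ => by simp))
    (fun n a p => LinearMap.ext fun m => by simp [← mk_balanced])))
  (fun m a t => by
    induction t using induction_on with
    | zero => simp
    | add s t hs ht => simp only [smul_add, map_add, hs, ht]
    | tmul n p => simp [mk_balanced])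

@[simp] theorem assocHom_mk (m : M) (n : N) (p : P) :
    assocHom A M N P (mk A _ P (mk A M N m n) p) = mk A M _ m (mk A N P n p) := rfl

@[simp] theorem assocInv_mk (m : M) (n : N) (p : P) :
    assocInv A M N P (mk A M _ m (mk A N P n p)) = mk A _ P (mk A M N m n) p := rfl

variable (A M N P) in
/-- The associativity isomorphism `(M ⊗_A N) ⊗_A P ≃ M ⊗_A (N ⊗_A P)`. -/
def assoc : BTensor A (BTensor A M N) P ≃ₗ[ℂ] BTensor A M (BTensor A N P) :=
  LinearEquiv.ofLinearMap (assocHom A M N P) (assocInv A M N P)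
    (LinearMap.ext fun t => by
      induction t using induction_on with
      | zero => simp
      | add s t hs ht => simp only [map_add, hs, ht]
      | tmul m t =>
        induction t using induction_on with
        | zero => simp
        | add s t hs ht => simp only [map_add, hs, ht]
        | tmul n p => simp)
    (LinearMap.ext fun t => by
      induction t using induction_on with
      | zero => simp
      | add s t hs ht => simp only [map_add, hs, ht]
      | tmul t p =>
        induction t using induction_on with
        | zero => simp
        | add s t hs ht => simp only [map_add, LinearMap.add_apply, hs, ht]
        | tmul m n => simp)

variable (A M) in
/-- `a ⊗ m ↦ a m`. -/
def leftUnitorHom : BTensor A A M →ₗ[ℂ] M :=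
  lift (lact A M) (fun b a m => by simp [mul_smul])

theorem leftUnitorHom_mk (a : A) (m : M) : leftUnitorHom A M (mk A A M a m) = a • m := rfl

variable (A M) in
/-- The unit isomorphism `A ⊗_A M ≃ M`, `a ⊗ m ↦ a m`. -/
def leftUnitor : BTensor A A M ≃ₗ[ℂ] M :=
  LinearEquiv.ofLinearMap (leftUnitorHom A M) (mk A A M 1)
    (LinearMap.ext fun m => (leftUnitorHom_mk 1 m).trans (one_smul A m))
    (LinearMap.ext fun t => by
      induction t using induction_on with
      | zero => simp
      | add s t hs ht => simp only [map_add, hs, ht]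
      | tmul a m =>
        rw [LinearMap.comp_apply, leftUnitorHom_mk, ← mk_balanced]
        simp)

variable (A M) in
/-- `m ⊗ a ↦ m a`. -/
def rightUnitorHom : BTensor A M A →ₗ[ℂ] M :=
  lift (ract A M) (fun m a b => by simp [mul_smul])

theorem rightUnitorHom_mk (a : A) (m : M) : rightUnitorHom A M (mk A M A m a) = op a • m := rfl

variable (A M) in
/-- The unit isomorphism `M ⊗_A A ≃ M`, `m ⊗ a ↦ m a`. -/
def rightUnitor : BTensor A M A ≃ₗ[ℂ] M :=
  LinearEquiv.ofLinearMap (rightUnitorHom A M) ((mk A M A).flip 1)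
    (LinearMap.ext fun m => (rightUnitorHom_mk 1 m).trans (one_smul Aᵐᵒᵖ m))
    (LinearMap.ext fun t => by
      induction t using induction_on with
      | zero => simp
      | add s t hs ht => simp only [map_add, hs, ht]
      | tmul m a =>
        rw [LinearMap.comp_apply, rightUnitorHom_mk, LinearMap.flip_apply, mk_balanced]
        simp)

end BTensor

/-- `cD` is a left dual of `cE` in the monoidal category of bicovariant bimodules: there are
morphisms `ev : D ⊗_A E → A` and `coev : A → E ⊗_A D` such that the composites
`E ≅ A ⊗ E → (E ⊗ D) ⊗ E ≅ E ⊗ (D ⊗ E) → E ⊗ A ≅ E` and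
`D ≅ D ⊗ A → D ⊗ (E ⊗ D) ≅ (D ⊗ E) ⊗ D → A ⊗ D ≅ D` are identities. -/
structure LeftDual (cE : Bicovariant A M) (cD : Bicovariant A N) where
  ev : BicovariantHom (cD.tensor cE) (Bicovariant.unit A)
  coev : BicovariantHom (Bicovariant.unit A) (cE.tensor cD)
  triangle_left : ∀ e : M, BTensor.rightUnitor A M (BTensor.map (BicovariantHom.id cE) ev
    (BTensor.assoc A M N M (BTensor.map coev (BicovariantHom.id cE)
      ((BTensor.leftUnitor A M).symm e)))) = e
  triangle_right : ∀ d : N, BTensor.leftUnitor A N (BTensor.map ev (BicovariantHom.id cD)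
    ((BTensor.assoc A N M N).symm (BTensor.map (BicovariantHom.id cD) coev
      ((BTensor.rightUnitor A N).symm d)))) = d

/-- A pseudo-Riemannian metric for `(M, σ)`: a right `A`-linear map `g : M ⊗_A M → A` with
`g ∘ σ = g` such that `g(ρ ⊗ ν) = 0` for all `ν` only if `ρ = 0`. -/
structure IsPseudoRiemannianMetric (cM : Bicovariant A M)
    (g : BTensor A M M →ₗ[Aᵐᵒᵖ] A) : Prop where
  symmetric : ∀ t, g (cM.braiding t) = g t
  nondegenerate : ∀ ρ : M, (∀ ν : M, g (BTensor.mk A M M ρ ν) = 0) → ρ = 0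

/-- `(id ⊗ ε g) Δ_{M ⊗ M} (ρ ⊗ ν) = g(ρ ⊗ ν)`. -/
def IsLeftInvariantMetric (cM : Bicovariant A M) (g : BTensor A M M →ₗ[Aᵐᵒᵖ] A) : Prop :=
  ∀ ρ ν : M, TensorProduct.rid ℂ A ((counit ∘ₗ g.restrictScalars ℂ).lTensor A
    ((cM.tensor cM).left (BTensor.mk A M M ρ ν))) = g (BTensor.mk A M M ρ ν)

/-- `(ε g ⊗ id) _{M ⊗ M}Δ (ρ ⊗ ν) = g(ρ ⊗ ν)`. -/
def IsRightInvariantMetric (cM : Bicovariant A M) (g : BTensor A M M →ₗ[Aᵐᵒᵖ] A) : Prop :=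
  ∀ ρ ν : M, TensorProduct.lid ℂ A ((counit ∘ₗ g.restrictScalars ℂ).rTensor A
    ((cM.tensor cM).right (BTensor.mk A M M ρ ν))) = g (BTensor.mk A M M ρ ν)

/-- `V_g : M → M*`, `V_g(e)(f) = g(e ⊗ f)`. -/
def metricMap (g : BTensor A M M →ₗ[Aᵐᵒᵖ] A) : M →ₗ[ℂ] RDual A M where
  toFun e :=
    ({ toFun := fun f => g (BTensor.mk A M M e f)
       map_add' := fun _ _ => by simp
       map_smul' := fun a f => map_smul g a (BTensor.mk A M M e f) } : M →ₗ[Aᵐᵒᵖ] A)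
  map_add' e e' := RDual.ext fun f =>
    (congrArg g (by simp)).trans (map_add g (BTensor.mk A M M e f) (BTensor.mk A M M e' f))
  map_smul' c e := RDual.ext fun f =>
    (congrArg g (by simp)).trans ((g.restrictScalars ℂ).map_smul c (BTensor.mk A M M e f))

@[simp] theorem metricMap_apply (g : BTensor A M M →ₗ[Aᵐᵒᵖ] A) (e f : M) :
    metricMap g e f = g (BTensor.mk A M M e f) := rfl

end Category

end HopfBimod

end

/-!
Write `V` for the left-invariant and `E₀` for the right-invariant elements of `E`. Two facts are
used throughout: `E = A V` and `E = E₀ A` (`leftInvariant_induction`, `rightInvariant_induction`).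
The antipode is not assumed to be bijective, so `E = V A` is not available at the outset; it is a
consequence of the existence of the metric.

*The metric has an invariant dual basis.* Bi-invariance makes `g` a morphism `E ⊗_A E → A`
(`metricHom`), so `g` takes complex values on `V ⊗ V`. Let `η ∈ V` satisfy `g(V ⊗ η) = 0`. Then
`g(E ⊗ η) = 0` because `E = A V`; for `ζ ∈ E₀` the symmetry of `g` gives
`g(η ⊗ ζ) = g(σ(η ⊗ ζ)) = g(ζ ⊗ η) = 0`; hence `g(η ⊗ E) = 0` because `E = E₀ A`, and `η = 0`
(`eq_zero_of_pairing_leftInvariant`). As `V` is finite-dimensional, it has dual bases `uᵢ`, `vᵢ`,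
and `∑ g(e ⊗ uᵢ) vᵢ = e` holds on `V` and so, by left linearity, on `E`. For the other identity
`∑ uᵢ g(vᵢ ⊗ e) = e` the difference `ν` of the two sides satisfies `g(vᵢ ⊗ ν) = 0` for all `i`.
Since `g(ω ⊗ S(a) e) = g(ω S(a) ⊗ e)`, the projection `e ↦ S(e₍₋₁₎) e₍₀₎` to `V` factors through the
functionals `g(vᵢ ⊗ -)` (`exists_leftProj_eq_sum`), which are left covariant; it therefore
annihilates the coaction of `ν`, and `ν = ν₍₋₂₎ S(ν₍₋₁₎) ν₍₀₎ = 0`.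

*Duality.* For any covariant pairing `N ⊗_A M → A` with an invariant dual basis, `a ↦ a ∑ uᵢ ⊗ vᵢ`
is a coevaluation (`InvariantDualBasis.leftDual`). Its right covariance is checked by contracting
with elements of `M₀`, which suffices because they generate `M` on the right. The same test shows
that a map into `N` compatible with the pairings is automatically covariant
(`left_covariant_of_pairing`, `right_covariant_of_pairing`).

*The dual bimodule.* The dual basis identity makes `V_g : E → E*` bijective, `φ` being the image of
`∑ φ(uᵢ) vᵢ`. The structure of `E` is transported to `E*` along `V_g`; the evaluation map then
corresponds to `g`, so it is a morphism with an invariant dual basis and `E*` is a left dual.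
Automatic covariance, applied to the identity of `E*` and to `x ↦ ev(x ⊗ -)`, yields uniqueness of the
structure and the comparison with an arbitrary left dual.
-/

noncomputable section

namespace HopfBimod

open Coalgebra TensorProduct HopfAlgebra

variable {A : Type*} [Ring A] [HopfAlgebra ℂ A]
  {M : Type*} [AddCommGroup M] [Module ℂ M] [Module A M] [Module Aᵐᵒᵖ M]
  [IsScalarTower ℂ A M] [IsScalarTower ℂ Aᵐᵒᵖ M] [SMulCommClass A Aᵐᵒᵖ M]
  {N : Type*} [AddCommGroup N] [Module ℂ N] [Module A N] [Module Aᵐᵒᵖ N]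
  [IsScalarTower ℂ A N] [IsScalarTower ℂ Aᵐᵒᵖ N] [SMulCommClass A Aᵐᵒᵖ N]
  {X : Type*} [AddCommGroup X] [Module ℂ X] [Module A X] [Module Aᵐᵒᵖ X]
  [IsScalarTower ℂ A X] [IsScalarTower ℂ Aᵐᵒᵖ X] [SMulCommClass A Aᵐᵒᵖ X]

/-! ### Invariant elements as generators -/

namespace Bicovariant

/-- `M` is generated as a left `A`-module by its left-invariant elements. -/
theorem leftInvariant_induction (cM : Bicovariant A M) {p : M → Prop} (zero : p 0)
    (add : ∀ x y, p x → p y → p (x + y)) (smul : ∀ (a : A), ∀ ω ∈ cM.leftInvariant, p (a • ω))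
    (m : M) : p m := by
  rw [← cM.lift_leftSplit m, leftSplit, LinearMap.comp_apply]
  generalize cM.left m = Z
  induction Z with
  | zero => simpa using zero
  | add _ _ h h' => simpa only [map_add] using add _ _ h h'
  | tmul a n => simpa using smul a _ (cM.leftProj_mem n)

/-- `M` is generated as a right `A`-module by its right-invariant elements. -/
theorem rightInvariant_induction (cM : Bicovariant A M) {p : M → Prop} (zero : p 0)
    (add : ∀ x y, p x → p y → p (x + y))
    (smul : ∀ (a : A), ∀ η ∈ cM.rightInvariant, p (op a • η)) (m : M) : p m := by
  rw [← cM.lift_rightSplit m, rightSplit, LinearMap.comp_apply]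
  generalize cM.right m = Z
  induction Z with
  | zero => simpa using zero
  | add _ _ h h' => simpa only [map_add] using add _ _ h h'
  | tmul n a => simpa using smul a _ (cM.rightProj_mem n)

end Bicovariant

/-! ### Covariant functionals and pairings -/

/-- An invariant functional `f = (id ⊗ ε f) Δ_M` is left covariant: apply `Δ` and use
coassociativity. -/
theorem lTensor_left_eq_comul (cM : Bicovariant A M) (f : M →ₗ[ℂ] A)
    (hf : ∀ m, TensorProduct.rid ℂ A ((counit ∘ₗ f).lTensor A (cM.left m)) = f m) (m : M) :
    f.lTensor A (cM.left m) = comul (f m) := by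
  have key : ∀ Z : A ⊗[ℂ] M,
      comul (TensorProduct.rid ℂ A ((counit ∘ₗ f).lTensor A Z)) =
        ((TensorProduct.rid ℂ A).toLinearMap ∘ₗ (counit ∘ₗ f).lTensor A).lTensor A
          (TensorProduct.assoc ℂ A A M (comul.rTensor M Z)) := by
    intro Z
    induction Z with
    | zero => simp
    | add _ _ h h' => simp only [map_add, h, h']
    | tmul a n =>
      simp only [LinearMap.lTensor_tmul, LinearMap.rTensor_tmul, TensorProduct.rid_tmul, map_smul,
        LinearMap.comp_apply]
      generalize (comul a : A ⊗[ℂ] A) = D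
      induction D with
      | zero => simp
      | add _ _ h h' => simp only [map_add, add_tmul, smul_add, h, h']
      | tmul c d => simp
  rw [← hf m, key, cM.left_coassoc, ← LinearMap.lTensor_comp_apply]
  congr 2
  exact LinearMap.ext fun n => (hf n).symm

/-- An invariant functional `f = (ε f ⊗ id) _MΔ` is right covariant. -/
theorem rTensor_right_eq_comul (cM : Bicovariant A M) (f : M →ₗ[ℂ] A)
    (hf : ∀ m, TensorProduct.lid ℂ A ((counit ∘ₗ f).rTensor A (cM.right m)) = f m) (m : M) :
    f.rTensor A (cM.right m) = comul (f m) := by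
  have key : ∀ Z : M ⊗[ℂ] A,
      comul (TensorProduct.lid ℂ A ((counit ∘ₗ f).rTensor A Z)) =
        ((TensorProduct.lid ℂ A).toLinearMap ∘ₗ (counit ∘ₗ f).rTensor A).rTensor A
          ((TensorProduct.assoc ℂ M A A).symm (comul.lTensor M Z)) := by
    intro Z
    induction Z with
    | zero => simp
    | add _ _ h h' => simp only [map_add, h, h']
    | tmul n a =>
      simp only [LinearMap.lTensor_tmul, LinearMap.rTensor_tmul, TensorProduct.lid_tmul, map_smul,
        LinearMap.comp_apply]
      generalize (comul a : A ⊗[ℂ] A) = D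
      induction D with
      | zero => simp
      | add _ _ h h' => simp only [map_add, tmul_add, smul_add, h, h']
      | tmul c d => simp [smul_tmul']
  rw [← hf m, key, ← cM.right_coassoc, LinearEquiv.symm_apply_apply,
    ← LinearMap.rTensor_comp_apply]
  congr 2
  exact LinearMap.ext fun n => (hf n).symm

namespace BicovariantHom

variable {cM : Bicovariant A M} {cN : Bicovariant A N}

/-- The bilinear map `(n, m) ↦ ev(n ⊗ m)` of a pairing `ev : N ⊗_A M → A`. -/
def pairing (ev : BicovariantHom (cN.tensor cM) (Bicovariant.unit A)) : N →ₗ[ℂ] M →ₗ[ℂ] A :=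
  (BTensor.mk A N M).compr₂ ev.toLinearMap

variable (ev : BicovariantHom (cN.tensor cM) (Bicovariant.unit A))

theorem pairing_apply (n : N) (m : M) : ev.pairing n m = ev (BTensor.mk A N M n m) := rfl

theorem pairing_smul (a : A) (n : N) (m : M) : ev.pairing (a • n) m = a * ev.pairing n m :=
  ev.map_smul_left a (BTensor.mk A N M n m)

theorem pairing_op_smul_right (a : A) (n : N) (m : M) :
    ev.pairing n (op a • m) = ev.pairing n m * a :=
  ev.map_smul_right a (BTensor.mk A N M n m)

theorem pairing_op_smul_left (a : A) (n : N) (m : M) :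
    ev.pairing (op a • n) m = ev.pairing n (a • m) :=
  congrArg ev.toLinearMap (BTensor.mk_balanced n a m)

theorem lTensor_pairing_flip (n : N) {ω : M} (hω : ω ∈ cM.leftInvariant) :
    (ev.pairing.flip ω).lTensor A (cN.left n) = comul (ev.pairing n ω) := by
  refine Eq.trans ?_ (ev.left_covariant (BTensor.mk A N M n ω))
  change _ = ev.toLinearMap.lTensor A (BTensor.leftPair A N M (cN.left n) (cM.left ω))
  rw [(cM.mem_leftInvariant ω).1 hω]
  generalize cN.left n = Z
  induction Z with
  | zero => simp
  | add _ _ h h' => simp only [map_add, LinearMap.add_apply, h, h']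
  | tmul a x => simp [BTensor.leftPair, pairing]

theorem lTensor_pairing {ω : N} (hω : ω ∈ cN.leftInvariant) (m : M) :
    (ev.pairing ω).lTensor A (cM.left m) = comul (ev.pairing ω m) := by
  refine Eq.trans ?_ (ev.left_covariant (BTensor.mk A N M ω m))
  change _ = ev.toLinearMap.lTensor A (BTensor.leftPair A N M (cN.left ω) (cM.left m))
  rw [(cN.mem_leftInvariant ω).1 hω]
  generalize cM.left m = Z
  induction Z with
  | zero => simp
  | add _ _ h h' => simp only [map_add, h, h']
  | tmul a x => simp [BTensor.leftPair, pairing]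

theorem rTensor_pairing_flip (n : N) {η : M} (hη : η ∈ cM.rightInvariant) :
    (ev.pairing.flip η).rTensor A (cN.right n) = comul (ev.pairing n η) := by
  refine Eq.trans ?_ (ev.right_covariant (BTensor.mk A N M n η))
  change _ = ev.toLinearMap.rTensor A (BTensor.rightPair A N M (cN.right n) (cM.right η))
  rw [(cM.mem_rightInvariant η).1 hη]
  generalize cN.right n = Z
  induction Z with
  | zero => simp
  | add _ _ h h' => simp only [map_add, LinearMap.add_apply, h, h']
  | tmul a x => simp [BTensor.rightPair, pairing]

/-- A covariant pairing of left-invariant elements takes values in `ℂ`. -/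
theorem pairing_eq_algebraMap {ω : N} (hω : ω ∈ cN.leftInvariant) {η : M}
    (hη : η ∈ cM.leftInvariant) :
    ev.pairing ω η = algebraMap ℂ A (counit (ev.pairing ω η)) := by
  have h := ev.lTensor_pairing hω η
  rw [(cM.mem_leftInvariant η).1 hη, LinearMap.lTensor_tmul] at h
  have h' := congrArg (TensorProduct.rid ℂ A ∘ counit.lTensor A) h
  simp only [Function.comp_apply, LinearMap.lTensor_tmul, TensorProduct.rid_tmul,
    lTensor_counit_comul, one_smul] at h'
  rw [Algebra.algebraMap_eq_smul_one, h']

/-- The composite of two morphisms. -/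
def comp {cX : Bicovariant A X} (f : BicovariantHom cN cX) (f' : BicovariantHom cM cN) :
    BicovariantHom cM cX where
  toLinearMap := f.toLinearMap ∘ₗ f'.toLinearMap
  map_smul_left a m := by simp [f'.map_smul_left, f.map_smul_left]
  map_smul_right a m := by simp [f'.map_smul_right, f.map_smul_right]
  left_covariant m := by
    rw [LinearMap.lTensor_comp_apply, f'.left_covariant, f.left_covariant]; rfl
  right_covariant m := by
    rw [LinearMap.rTensor_comp_apply, f'.right_covariant, f.right_covariant]; rfl

end BicovariantHom

/-- The inverse of a bijective morphism is a morphism. -/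
def BicovariantIso.ofInverse {cM : Bicovariant A M} {cN : Bicovariant A N}
    (f : BicovariantHom cM cN) (k : N →ₗ[ℂ] M) (hkf : ∀ m, k (f m) = m)
    (hfk : ∀ n, f (k n) = n) : BicovariantIso cM cN where
  hom := f
  inv :=
    { toLinearMap := k
      map_smul_left := fun a n => by
        conv_lhs => rw [← hfk n, ← f.map_smul_left, hkf]
      map_smul_right := fun a n => by
        conv_lhs => rw [← hfk n, ← f.map_smul_right, hkf]
      left_covariant := fun n => by
        conv_lhs => rw [← hfk n, ← f.left_covariant, ← LinearMap.lTensor_comp_apply,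
          show k ∘ₗ f.toLinearMap = LinearMap.id from LinearMap.ext hkf, LinearMap.lTensor_id,
          LinearMap.id_apply]
      right_covariant := fun n => by
        conv_lhs => rw [← hfk n, ← f.right_covariant, ← LinearMap.rTensor_comp_apply,
          show k ∘ₗ f.toLinearMap = LinearMap.id from LinearMap.ext hkf, LinearMap.rTensor_id,
          LinearMap.id_apply] }
  inv_hom := hkf
  hom_inv := hfk

namespace BicovariantIso

/-- The inverse isomorphism. -/
def symm {cM : Bicovariant A M} {cN : Bicovariant A N} (f : BicovariantIso cM cN) :
    BicovariantIso cN cM := ⟨f.inv, f.hom, f.hom_inv, f.inv_hom⟩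

/-- The composite isomorphism, `f` first. -/
def trans {cM : Bicovariant A M} {cN : Bicovariant A N} {cX : Bicovariant A X}
    (f : BicovariantIso cM cN) (k : BicovariantIso cN cX) : BicovariantIso cM cX where
  hom := k.hom.comp f.hom
  inv := f.inv.comp k.inv
  inv_hom m := by simp [BicovariantHom.comp, k.inv_hom, f.inv_hom]
  hom_inv m := by simp [BicovariantHom.comp, k.hom_inv, f.hom_inv]

end BicovariantIso

variable {cM : Bicovariant A M} {cN : Bicovariant A N} {cX : Bicovariant A X}

/-! ### Pairings with left-invariant dual bases -/

/-- Finite families `u` in `M` and `v` in `N` of left-invariant elements which are dual to each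
other under the pairing `ev : N ⊗_A M → A`: every `n` is `∑ ev(n ⊗ uᵢ) vᵢ` and every `m` is
`∑ uᵢ ev(vᵢ ⊗ m)`. -/
structure InvariantDualBasis (ev : BicovariantHom (cN.tensor cM) (Bicovariant.unit A))
    (ι : Type*) [Fintype ι] where
  u : ι → M
  v : ι → N
  u_mem : ∀ i, u i ∈ cM.leftInvariant
  v_mem : ∀ i, v i ∈ cN.leftInvariant
  sum_left : ∀ n, ∑ i, ev.pairing n (u i) • v i = n
  sum_right : ∀ m, ∑ i, op (ev.pairing (v i) m) • u i = m

namespace BicovariantHom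

variable (ev : BicovariantHom (cN.tensor cM) (Bicovariant.unit A))

/-- The contraction `M ⊗_A N → M`, `x ⊗ n ↦ x ev(n ⊗ m)`. -/
def contract (m : M) : BTensor A M N →ₗ[ℂ] M :=
  BTensor.lift ((ract A M).compl₂ (ev.pairing.flip m)) (fun x a n => by
    simp [pairing_smul, mul_smul])

theorem contract_mk (m x : M) (n : N) :
    ev.contract m (BTensor.mk A M N x n) = op (ev.pairing n m) • x := rfl

theorem contract_op_smul (a : A) (m : M) :
    ev.contract (op a • m) = (ract A M).flip a ∘ₗ ev.contract m := by
  refine LinearMap.ext fun t => ?_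
  induction t using BTensor.induction_on with
  | zero => simp
  | add s t hs ht => simp only [map_add, hs, ht]
  | tmul x n => simp [contract_mk, pairing_op_smul_right, mul_smul]

theorem contract_add (m m' : M) : ev.contract (m + m') = ev.contract m + ev.contract m' := by
  refine LinearMap.ext fun t => ?_
  induction t using BTensor.induction_on with
  | zero => simp
  | add s t hs ht => simp only [map_add, hs, ht]
  | tmul x n => simp [contract_mk, add_smul]

theorem contract_zero : ev.contract 0 = 0 := by
  refine LinearMap.ext fun t => ?_
  induction t using BTensor.induction_on with
  | zero => simp
  | add s t hs ht => simp only [map_add, hs, ht]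
  | tmul x n => simp [contract_mk]

/-- Contraction with a right-invariant element is right covariant. -/
theorem rTensor_contract {η : M} (hη : η ∈ cM.rightInvariant) (t : BTensor A M N) :
    (ev.contract η).rTensor A ((cM.tensor cN).right t) = cM.right (ev.contract η t) := by
  have key : ∀ (Z : M ⊗[ℂ] A) (W : N ⊗[ℂ] A),
      (ev.contract η).rTensor A (BTensor.rightPair A M N Z W) =
        map₂ (ract A M) (LinearMap.mul ℂ A) Z ((ev.pairing.flip η).rTensor A W) := by
    intro Z W
    induction Z with
    | zero => simp
    | add _ _ h h' => simp only [map_add, LinearMap.add_apply, h, h']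
    | tmul x a =>
      induction W with
      | zero => simp
      | add _ _ h h' => simp only [map_add, h, h']
      | tmul n b => simp [BTensor.rightPair, contract_mk]
  induction t using BTensor.induction_on with
  | zero => simp
  | add s t hs ht => simp only [map_add, hs, ht]
  | tmul x n =>
    change (ev.contract η).rTensor A (BTensor.rightPair A M N (cM.right x) (cN.right n)) = _
    rw [key, ev.rTensor_pairing_flip n hη, contract_mk, cM.right_op_smul]

end BicovariantHom

namespace InvariantDualBasis

variable {ev : BicovariantHom (cN.tensor cM) (Bicovariant.unit A)} {ι : Type*} [Fintype ι]
  (D : InvariantDualBasis ev ι)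

/-- The canonical element `∑ uᵢ ⊗ vᵢ` of `M ⊗_A N`. -/
def elt : BTensor A M N := ∑ i, BTensor.mk A M N (D.u i) (D.v i)

theorem op_smul_elt (a : A) : op a • D.elt = a • D.elt := by
  have h : ∀ i, BTensor.mk A M N (D.u i) (op a • D.v i) =
      ∑ j, BTensor.mk A M N (op (ev.pairing (D.v i) (a • D.u j)) • D.u i) (D.v j) := by
    intro i
    conv_lhs => rw [← D.sum_left (op a • D.v i), map_sum]
    simp only [BTensor.mk_balanced, ev.pairing_op_smul_left]
  simp only [elt, Finset.smul_sum, BTensor.op_smul_mk, BTensor.smul_mk, h]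
  rw [Finset.sum_comm]
  refine Finset.sum_congr rfl fun j _ => ?_
  conv_rhs => rw [← D.sum_right (a • D.u j), map_sum, LinearMap.sum_apply]

theorem left_elt : (cM.tensor cN).left D.elt = 1 ⊗ₜ D.elt := by
  simp only [elt, map_sum, tmul_sum]
  refine Finset.sum_congr rfl fun i _ => ?_
  change BTensor.leftPair A M N (cM.left (D.u i)) (cN.left (D.v i)) = _
  rw [(cM.mem_leftInvariant _).1 (D.u_mem i), (cN.mem_leftInvariant _).1 (D.v_mem i)]
  simp [BTensor.leftPair]

theorem contract_elt (m : M) : ev.contract m D.elt = m := by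
  simp only [elt, map_sum, ev.contract_mk, D.sum_right]

theorem sum_mk_contract (t : BTensor A M N) :
    ∑ i, BTensor.mk A M N (ev.contract (D.u i) t) (D.v i) = t := by
  induction t using BTensor.induction_on with
  | zero => simp
  | add s t hs ht =>
    simp only [map_add, LinearMap.add_apply, Finset.sum_add_distrib, hs, ht]
  | tmul x n =>
    simp only [ev.contract_mk, BTensor.mk_balanced]
    rw [← map_sum, D.sum_left]

/-- Contractions with right-invariant elements separate the points of `(M ⊗_A N) ⊗ A`, because
the right-invariant elements generate `M` as a right module. -/
theorem eq_of_rTensor_contract (D : InvariantDualBasis ev ι) {Z Z' : BTensor A M N ⊗[ℂ] A}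
    (h : ∀ η ∈ cM.rightInvariant,
      (ev.contract η).rTensor A Z = (ev.contract η).rTensor A Z') : Z = Z' := by
  have h' : ∀ m, (ev.contract m).rTensor A Z = (ev.contract m).rTensor A Z' := by
    intro m
    induction m using cM.rightInvariant_induction with
    | zero => simp only [ev.contract_zero, LinearMap.rTensor_zero, LinearMap.zero_apply]
    | add x y hx hy =>
      simp only [ev.contract_add, LinearMap.rTensor_add, LinearMap.add_apply, hx, hy]
    | smul a η hη => simp only [ev.contract_op_smul, LinearMap.rTensor_comp_apply, h η hη]
  have hid : ∑ i, (BTensor.mk A M N).flip (D.v i) ∘ₗ ev.contract (D.u i) = LinearMap.id :=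
    LinearMap.ext fun t => by simpa using D.sum_mk_contract t
  have hZ : ∀ W : BTensor A M N ⊗[ℂ] A, W = ∑ i, ((BTensor.mk A M N).flip (D.v i)).rTensor A
      ((ev.contract (D.u i)).rTensor A W) := by
    intro W
    conv_lhs => rw [← LinearMap.rTensor_id_apply A _ W, ← hid]
    simp only [← LinearMap.coe_rTensorHom, map_sum, LinearMap.sum_apply]
    simp only [LinearMap.coe_rTensorHom, LinearMap.rTensor_comp_apply]
  rw [hZ Z, hZ Z']
  simp only [h']

theorem right_elt : (cM.tensor cN).right D.elt = D.elt ⊗ₜ 1 := by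
  refine D.eq_of_rTensor_contract fun η hη => ?_
  rw [ev.rTensor_contract hη, D.contract_elt, LinearMap.rTensor_tmul, D.contract_elt]
  exact (cM.mem_rightInvariant η).1 hη

/-- The coevaluation `a ↦ a ∑ uᵢ ⊗ vᵢ`. -/
def coev : BicovariantHom (Bicovariant.unit A) (cM.tensor cN) where
  toLinearMap := (lact A (BTensor A M N)).flip D.elt
  map_smul_left b a := by simp [mul_smul]
  map_smul_right b a := by
    rw [LinearMap.flip_apply, LinearMap.flip_apply, lact_apply, lact_apply, op_smul_eq_mul,
      mul_smul, ← D.op_smul_elt b]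
    exact smul_comm _ _ _
  left_covariant a := by
    change _ = (cM.tensor cN).left (a • D.elt)
    rw [(cM.tensor cN).left_smul, D.left_elt]
    change LinearMap.lTensor A _ (comul a) = _
    generalize (comul a : A ⊗[ℂ] A) = Z
    induction Z with
    | zero => simp
    | add _ _ h h' => simp only [map_add, LinearMap.add_apply, h, h']
    | tmul x y => simp
  right_covariant a := by
    change _ = (cM.tensor cN).right (a • D.elt)
    rw [(cM.tensor cN).right_smul, D.right_elt]
    change LinearMap.rTensor A _ (comul a) = _
    generalize (comul a : A ⊗[ℂ] A) = Z
    induction Z with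
    | zero => simp
    | add _ _ h h' => simp only [map_add, LinearMap.add_apply, h, h']
    | tmul x y => simp

theorem coev_one : D.coev 1 = D.elt := one_smul A D.elt

/-- A covariant pairing with an invariant dual basis exhibits `N` as a left dual of `M`. -/
def leftDual : LeftDual cM cN where
  ev := ev
  coev := D.coev
  triangle_left e := by
    change BTensor.rightUnitor A M (BTensor.map (BicovariantHom.id cM) ev
      (BTensor.assoc A M N M (BTensor.mk A _ M (D.coev 1) e))) = e
    rw [coev_one, elt]
    simp only [map_sum, LinearMap.sum_apply]
    exact D.sum_right e
  triangle_right d := by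
    change BTensor.leftUnitor A N (BTensor.map ev (BicovariantHom.id cN)
      ((BTensor.assoc A N M N).symm (BTensor.mk A N _ d (D.coev 1)))) = d
    rw [coev_one, elt]
    simp only [map_sum]
    exact D.sum_left d

/-- A linear map `f : X → N` that intertwines covariant pairings of `X` and of `N` with `M` is
left covariant: pairing with the left-invariant elements `uᵢ` determines elements of `A ⊗ N`. -/
theorem left_covariant_of_pairing (D : InvariantDualBasis ev ι)
    (ev' : BicovariantHom (cX.tensor cM) (Bicovariant.unit A))
    (f : X →ₗ[ℂ] N) (hf : ∀ x m, ev.pairing (f x) m = ev'.pairing x m) (x : X) :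
    f.lTensor A (cX.left x) = cN.left (f x) := by
  have hid : ∑ i, (lact A N).flip (D.v i) ∘ₗ ev.pairing.flip (D.u i) = LinearMap.id :=
    LinearMap.ext fun n => by simpa using D.sum_left n
  have hZ : ∀ W : A ⊗[ℂ] N, W = ∑ i, ((lact A N).flip (D.v i)).lTensor A
      ((ev.pairing.flip (D.u i)).lTensor A W) := by
    intro W
    conv_lhs => rw [← LinearMap.lTensor_id_apply A _ W, ← hid]
    simp only [← LinearMap.coe_lTensorHom, map_sum, LinearMap.sum_apply]
    simp only [LinearMap.coe_lTensorHom, LinearMap.lTensor_comp_apply]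
  rw [hZ (cN.left (f x)), hZ (f.lTensor A (cX.left x))]
  refine Finset.sum_congr rfl fun i _ => ?_
  rw [ev.lTensor_pairing_flip _ (D.u_mem i), ← LinearMap.lTensor_comp_apply A _ f,
    show ev.pairing.flip (D.u i) ∘ₗ f = ev'.pairing.flip (D.u i) from
      LinearMap.ext fun y => hf y _,
    ev'.lTensor_pairing_flip _ (D.u_mem i), hf]

/-- Right counterpart of `left_covariant_of_pairing`. The `uᵢ` need not be right-invariant, so the
pairing is tested against right-invariant elements, which generate `M` as a right module. -/
theorem right_covariant_of_pairing (D : InvariantDualBasis ev ι)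
    (ev' : BicovariantHom (cX.tensor cM) (Bicovariant.unit A))
    (f : X →ₗ[ℂ] N) (hf : ∀ x m, ev.pairing (f x) m = ev'.pairing x m) (x : X) :
    f.rTensor A (cX.right x) = cN.right (f x) := by
  have hid : ∑ i, (lact A N).flip (D.v i) ∘ₗ ev.pairing.flip (D.u i) = LinearMap.id :=
    LinearMap.ext fun n => by simpa using D.sum_left n
  have hZ : ∀ W : N ⊗[ℂ] A, W = ∑ i, ((lact A N).flip (D.v i)).rTensor A
      ((ev.pairing.flip (D.u i)).rTensor A W) := by
    intro W
    conv_lhs => rw [← LinearMap.rTensor_id_apply A _ W, ← hid]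
    simp only [← LinearMap.coe_rTensorHom, map_sum, LinearMap.sum_apply]
    simp only [LinearMap.coe_rTensorHom, LinearMap.rTensor_comp_apply]
  have h : ∀ m, (ev.pairing.flip m).rTensor A (f.rTensor A (cX.right x)) =
      (ev.pairing.flip m).rTensor A (cN.right (f x)) := by
    intro m
    induction m using cM.rightInvariant_induction with
    | zero => simp only [map_zero, LinearMap.rTensor_zero, LinearMap.zero_apply]
    | add y z hy hz => simp only [map_add, LinearMap.rTensor_add, LinearMap.add_apply, hy, hz]
    | smul a η hη =>
      have hs : ev.pairing.flip (op a • η) = (ract A A).flip a ∘ₗ ev.pairing.flip η :=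
        LinearMap.ext fun n => ev.pairing_op_smul_right a n η
      rw [hs, LinearMap.rTensor_comp_apply, LinearMap.rTensor_comp_apply,
        ev.rTensor_pairing_flip _ hη, ← LinearMap.rTensor_comp_apply A _ f,
        show ev.pairing.flip η ∘ₗ f = ev'.pairing.flip η from LinearMap.ext fun y => hf y _,
        ev'.rTensor_pairing_flip _ hη, hf]
  rw [hZ (cN.right (f x)), hZ (f.rTensor A (cX.right x))]
  simp only [h]

end InvariantDualBasis

/-! ### Bi-invariant metrics -/

/-- A bi-invariant bilinear metric, as a morphism of bicovariant bimodules. -/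
def metricHom (cM : Bicovariant A M) (g : BTensor A M M →ₗ[Aᵐᵒᵖ] A)
    (hglin : ∀ (a : A) (t : BTensor A M M), g (a • t) = a * g t)
    (hgl : IsLeftInvariantMetric cM g) (hgr : IsRightInvariantMetric cM g) :
    BicovariantHom (cM.tensor cM) (Bicovariant.unit A) where
  toLinearMap := g.restrictScalars ℂ
  map_smul_left := hglin
  map_smul_right a t := map_smul g (op a) t
  left_covariant := lTensor_left_eq_comul _ _ fun t => by
    induction t using BTensor.induction_on with
    | zero => simp
    | add s t hs ht => simp only [map_add, hs, ht]
    | tmul m n => exact hgl m n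
  right_covariant := rTensor_right_eq_comul _ _ fun t => by
    induction t using BTensor.induction_on with
    | zero => simp
    | add s t hs ht => simp only [map_add, hs, ht]
    | tmul m n => exact hgr m n

namespace BicovariantHom

variable (ev : BicovariantHom (cM.tensor cM) (Bicovariant.unit A))

/-- A nondegenerate symmetric pairing separates left-invariant elements in its second argument as
well. If `η` is orthogonal to all left-invariant elements, then `ev(M ⊗ η) = 0`. For right-invariant
`ζ` the symmetry reads `ev(η ⊗ ζ) = ev(ζ ⊗ η) = 0`, and such `ζ` generate `M` on the right. -/
theorem eq_zero_of_pairing_leftInvariant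
    (hsymm : ∀ t, ev (cM.braiding t) = ev t)
    (hnd : ∀ ρ : M, (∀ ν : M, ev.pairing ρ ν = 0) → ρ = 0)
    {η : M} (hη : η ∈ cM.leftInvariant) (h : ∀ ω ∈ cM.leftInvariant, ev.pairing ω η = 0) :
    η = 0 := by
  have hl : ∀ m, ev.pairing m η = 0 := fun m => by
    induction m using cM.leftInvariant_induction with
    | zero => simp
    | add x y hx hy => rw [map_add, LinearMap.add_apply, hx, hy, add_zero]
    | smul a ω hω => rw [ev.pairing_smul, h ω hω, mul_zero]
  refine hnd η fun m => ?_
  induction m using cM.rightInvariant_induction with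
  | zero => simp
  | add x y hx hy => rw [map_add, hx, hy, add_zero]
  | smul a ζ hζ =>
    rw [ev.pairing_op_smul_right, ev.pairing_apply, ← hsymm, cM.braiding_mk hη hζ,
      ← ev.pairing_apply, hl, zero_mul]

/-- The complex bilinear form `ε ∘ ev` on the left-invariant elements. -/
def invariantForm : LinearMap.BilinForm ℂ cM.leftInvariant :=
  (ev.pairing.compr₂ counit).compl₁₂ cM.leftInvariant.subtype cM.leftInvariant.subtype

theorem algebraMap_invariantForm (ω η : cM.leftInvariant) :
    algebraMap ℂ A (ev.invariantForm ω η) = ev.pairing ω η :=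
  (ev.pairing_eq_algebraMap ω.2 η.2).symm

theorem sum_pairing_left {ι : Type*} [Fintype ι] {u v : ι → M}
    (hu : ∀ ω ∈ cM.leftInvariant, ∑ i, ev.pairing ω (u i) • v i = ω) (m : M) :
    ∑ i, ev.pairing m (u i) • v i = m := by
  induction m using cM.leftInvariant_induction with
  | zero => simp
  | add x y hx hy =>
    simp only [map_add, LinearMap.add_apply, add_smul, Finset.sum_add_distrib, hx, hy]
  | smul a ω hω => simp only [ev.pairing_smul, mul_smul, ← Finset.smul_sum, hu ω hω]

/-- The projection `e ↦ S(e₍₋₁₎) e₍₀₎` onto the left-invariant elements factors through finitely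
many functionals `ev(vᵢ ⊗ -)`: expand `ω S(e₍₋₁₎) = ∑ cᵢ(e₍₋₁₎) vᵢ` in
`ev(ω ⊗ S(e₍₋₁₎) e₍₀₎) = ev(ω S(e₍₋₁₎) ⊗ e₍₀₎)` and use that `ev(vᵢ ⊗ -)` is left covariant. -/
theorem exists_leftProj_eq_sum {ι : Type*} [Fintype ι] {u v : ι → M}
    (hv : ∀ i, v i ∈ cM.leftInvariant)
    (hleft : ∀ m, ∑ i, ev.pairing m (u i) • v i = m)
    (hright : ∀ ω ∈ cM.leftInvariant, ∑ i, op (ev.pairing (v i) ω) • u i = ω) :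
    ∃ W : ι → A →ₗ[ℂ] M, ∀ m, cM.leftProj m = ∑ i, W i (ev.pairing (v i) m) := by
  let c : M → ι → A →ₗ[ℂ] A := fun ω i =>
    ev.pairing.flip (u i) ∘ₗ ract A M ω ∘ₗ antipode ℂ
  let G : M → ι → A →ₗ[ℂ] A := fun ω i =>
    TensorProduct.lift ((LinearMap.mul ℂ A).comp (c ω i)) ∘ₗ comul
  have hG : ∀ ω m, ev.pairing ω (cM.leftProj m) = ∑ i, G ω i (ev.pairing (v i) m) := by
    intro ω m
    simp only [G, LinearMap.comp_apply, ← ev.lTensor_pairing (hv _), Bicovariant.leftProj]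
    generalize cM.left m = Z
    induction Z with
    | zero => simp
    | add _ _ h h' => simp only [map_add, Finset.sum_add_distrib, h, h']
    | tmul x y =>
      simp only [lift.tmul, LinearMap.comp_apply, LinearMap.lTensor_tmul, lact_apply,
        ← ev.pairing_op_smul_left]
      conv_lhs => rw [← hleft (op (antipode ℂ x) • ω), map_sum, LinearMap.sum_apply]
      simp only [ev.pairing_smul]
      rfl
  refine ⟨fun i => ∑ k, (LinearMap.toSpanSingleton ℂ M (u k)) ∘ₗ counit ∘ₗ G (v k) i,
    fun m => ?_⟩
  conv_lhs => rw [← hright _ (cM.leftProj_mem m)]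
  simp only [LinearMap.sum_apply]
  rw [Finset.sum_comm]
  refine Finset.sum_congr rfl fun k _ => ?_
  rw [ev.pairing_eq_algebraMap (hv k) (cM.leftProj_mem m), hG, ← MulOpposite.algebraMap_apply,
    algebraMap_smul, map_sum, Finset.sum_smul]
  rfl

/-- The pairing is nondegenerate in its second argument: if `ev(vᵢ ⊗ ν) = 0` for all `i`, then
`(id ⊗ ev(vᵢ ⊗ -)) Δ_M(ν) = 0`, hence `ν = ν₍₋₂₎ S(ν₍₋₁₎) ν₍₀₎ = 0`. -/
theorem eq_zero_of_pairing_eq_zero {ι : Type*} [Fintype ι] {u v : ι → M}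
    (hv : ∀ i, v i ∈ cM.leftInvariant)
    (hleft : ∀ m, ∑ i, ev.pairing m (u i) • v i = m)
    (hright : ∀ ω ∈ cM.leftInvariant, ∑ i, op (ev.pairing (v i) ω) • u i = ω)
    {ν : M} (hν : ∀ i, ev.pairing (v i) ν = 0) : ν = 0 := by
  obtain ⟨W, hW⟩ := ev.exists_leftProj_eq_sum hv hleft hright
  have hW' : cM.leftProj = ∑ i, W i ∘ₗ ev.pairing (v i) :=
    LinearMap.ext fun m => by simpa using hW m
  rw [← cM.lift_leftSplit ν, Bicovariant.leftSplit, LinearMap.comp_apply, hW']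
  simp only [← LinearMap.coe_lTensorHom, map_sum, LinearMap.sum_apply]
  simp only [LinearMap.coe_lTensorHom, LinearMap.lTensor_comp_apply, ev.lTensor_pairing (hv _),
    hν, map_zero, Finset.sum_const_zero]

/-- A nondegenerate symmetric covariant pairing on a finite bicovariant bimodule has an invariant
dual basis. -/
theorem exists_invariantDualBasis [FiniteDimensional ℂ cM.leftInvariant]
    (hsymm : ∀ t, ev (cM.braiding t) = ev t)
    (hnd : ∀ ρ : M, (∀ ν : M, ev.pairing ρ ν = 0) → ρ = 0) :
    ∃ n, Nonempty (InvariantDualBasis ev (Fin n)) := by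
  have hB : ev.invariantForm.Nondegenerate := by
    refine LinearMap.BilinForm.Nondegenerate.ofSeparatingRight fun η h => Subtype.ext ?_
    refine ev.eq_zero_of_pairing_leftInvariant hsymm hnd η.2 fun ω hω => ?_
    rw [← ev.algebraMap_invariantForm ⟨ω, hω⟩ η, h, map_zero]
  let b := Module.finBasis ℂ cM.leftInvariant
  let b' := LinearMap.BilinForm.dualBasis ev.invariantForm hB b
  let u : Fin _ → M := fun i => b i
  let v : Fin _ → M := fun i => b' i
  have hl : ∀ ω ∈ cM.leftInvariant, ∑ i, ev.pairing ω (u i) • v i = ω := by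
    intro ω hω
    have h : ∀ i, ev.invariantForm ⟨ω, hω⟩ (b i) = b'.repr ⟨ω, hω⟩ i := fun i =>
      (LinearMap.BilinForm.dualBasis_repr_apply hB b ⟨ω, hω⟩ i).symm
    have h2 := congrArg cM.leftInvariant.subtype (b'.sum_repr ⟨ω, hω⟩)
    simp only [map_sum, map_smul, Submodule.subtype_apply] at h2
    conv_rhs => rw [← h2]
    refine Finset.sum_congr rfl fun i _ => ?_
    rw [← h, ← algebraMap_smul A, ev.algebraMap_invariantForm]
  have hr : ∀ ω ∈ cM.leftInvariant, ∑ i, op (ev.pairing (v i) ω) • u i = ω := by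
    intro ω hω
    have h : ∀ i, ev.invariantForm (b' i) ⟨ω, hω⟩ = b.repr ⟨ω, hω⟩ i := fun i => by
      conv_lhs => rw [← b.sum_repr ⟨ω, hω⟩]
      simp only [b', map_sum, map_smul, smul_eq_mul, LinearMap.BilinForm.apply_dualBasis_left,
        mul_ite, mul_one, mul_zero, Finset.sum_ite_eq', Finset.mem_univ, if_true]
    have h2 := congrArg cM.leftInvariant.subtype (b.sum_repr ⟨ω, hω⟩)
    simp only [map_sum, map_smul, Submodule.subtype_apply] at h2
    conv_rhs => rw [← h2]
    refine Finset.sum_congr rfl fun i _ => ?_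
    rw [← h, ← algebraMap_smul Aᵐᵒᵖ, MulOpposite.algebraMap_apply, ev.algebraMap_invariantForm]
  have hu : ∀ i, u i ∈ cM.leftInvariant := fun i => (b i).2
  have hv : ∀ i, v i ∈ cM.leftInvariant := fun i => (b' i).2
  have hl' := ev.sum_pairing_left hl
  refine ⟨_, ⟨⟨u, v, hu, hv, hl', fun m => ?_⟩⟩⟩
  rw [← sub_eq_zero]
  refine ev.eq_zero_of_pairing_eq_zero hv hl' hr fun i => ?_
  -- `v i` is `∑ ev(vᵢ ⊗ uⱼ) vⱼ`, so pairing it with the two sides gives the same result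
  rw [map_sub, map_sum, sub_eq_zero]
  conv_rhs => rw [← hl' (v i), map_sum, LinearMap.sum_apply]
  simp only [ev.pairing_op_smul_right, ev.pairing_smul]

end BicovariantHom

/-! ### The dual bimodule -/

/-- The bicovariant structure on `N` transported along a bimodule isomorphism `M ≃ N`. -/
def Bicovariant.transport (cM : Bicovariant A M) (f : M ≃ₗ[ℂ] N)
    (hl : ∀ (a : A) (m : M), f (a • m) = a • f m)
    (hr : ∀ (a : A) (m : M), f (op a • m) = op a • f m) : Bicovariant A N where
  left := f.toLinearMap.lTensor A ∘ₗ cM.left ∘ₗ f.symm.toLinearMap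
  right := f.toLinearMap.rTensor A ∘ₗ cM.right ∘ₗ f.symm.toLinearMap
  left_coassoc n := by
    obtain ⟨m, rfl⟩ := f.surjective n
    have h : ∀ Z : A ⊗[ℂ] M, TensorProduct.assoc ℂ A A N
        (comul.rTensor N (f.toLinearMap.lTensor A Z)) = (f.toLinearMap.lTensor A).lTensor A
          (TensorProduct.assoc ℂ A A M (comul.rTensor M Z)) := by
      intro Z
      induction Z with
      | zero => simp
      | add _ _ h h' => simp only [map_add, h, h']
      | tmul a x =>
        simp only [LinearMap.lTensor_tmul, LinearMap.rTensor_tmul]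
        generalize (comul a : A ⊗[ℂ] A) = D
        induction D with
        | zero => simp
        | add _ _ h h' => simp only [map_add, add_tmul, h, h']
        | tmul c d => simp
    simp only [LinearMap.comp_apply, LinearEquiv.coe_coe, LinearEquiv.symm_apply_apply, h,
      cM.left_coassoc]
    rw [← LinearMap.lTensor_comp_apply, ← LinearMap.lTensor_comp_apply]
    congr 2
    ext x
    simp
  left_counit n := by
    obtain ⟨m, rfl⟩ := f.surjective n
    simp only [LinearMap.comp_apply, LinearEquiv.coe_coe, LinearEquiv.symm_apply_apply]
    conv_rhs => rw [← cM.left_counit m]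
    generalize cM.left m = Z
    induction Z with
    | zero => simp
    | add _ _ h h' => simp only [map_add, h, h']
    | tmul a x => simp
  right_coassoc n := by
    obtain ⟨m, rfl⟩ := f.surjective n
    have h : ∀ Z : M ⊗[ℂ] A, (TensorProduct.assoc ℂ N A A).symm
        (comul.lTensor N (f.toLinearMap.rTensor A Z)) = (f.toLinearMap.rTensor A).rTensor A
          ((TensorProduct.assoc ℂ M A A).symm (comul.lTensor M Z)) := by
      intro Z
      induction Z with
      | zero => simp
      | add _ _ h h' => simp only [map_add, h, h']
      | tmul x a =>
        simp only [LinearMap.lTensor_tmul, LinearMap.rTensor_tmul]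
        generalize (comul a : A ⊗[ℂ] A) = D
        induction D with
        | zero => simp
        | add _ _ h h' => simp only [map_add, tmul_add, h, h']
        | tmul c d => simp
    rw [← LinearEquiv.eq_symm_apply]
    simp only [LinearMap.comp_apply, LinearEquiv.coe_coe, LinearEquiv.symm_apply_apply, h,
      ← cM.right_coassoc]
    rw [← LinearMap.rTensor_comp_apply, ← LinearMap.rTensor_comp_apply]
    congr 2
    ext x
    simp
  right_counit n := by
    obtain ⟨m, rfl⟩ := f.surjective n
    simp only [LinearMap.comp_apply, LinearEquiv.coe_coe, LinearEquiv.symm_apply_apply]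
    conv_rhs => rw [← cM.right_counit m]
    generalize cM.right m = Z
    induction Z with
    | zero => simp
    | add _ _ h h' => simp only [map_add, h, h']
    | tmul a x => simp
  left_smul a n := by
    obtain ⟨m, rfl⟩ := f.surjective n
    simp only [LinearMap.comp_apply, LinearEquiv.coe_coe, ← hl, LinearEquiv.symm_apply_apply,
      cM.left_smul]
    generalize cM.left m = Z
    generalize (comul a : A ⊗[ℂ] A) = D
    induction Z with
    | zero => simp
    | add _ _ h h' => simp only [map_add, h, h']
    | tmul b x =>
      induction D with
      | zero => simp
      | add _ _ h h' => simp only [map_add, LinearMap.add_apply, h, h']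
      | tmul c d => simp [hl]
  left_op_smul a n := by
    obtain ⟨m, rfl⟩ := f.surjective n
    simp only [LinearMap.comp_apply, LinearEquiv.coe_coe, ← hr, LinearEquiv.symm_apply_apply,
      cM.left_op_smul]
    generalize cM.left m = Z
    generalize (comul a : A ⊗[ℂ] A) = D
    induction Z with
    | zero => simp
    | add _ _ h h' => simp only [map_add, LinearMap.add_apply, h, h']
    | tmul b x =>
      induction D with
      | zero => simp
      | add _ _ h h' => simp only [map_add, h, h']
      | tmul c d => simp [hr]
  right_smul a n := by
    obtain ⟨m, rfl⟩ := f.surjective n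
    simp only [LinearMap.comp_apply, LinearEquiv.coe_coe, ← hl, LinearEquiv.symm_apply_apply,
      cM.right_smul]
    generalize cM.right m = Z
    generalize (comul a : A ⊗[ℂ] A) = D
    induction Z with
    | zero => simp
    | add _ _ h h' => simp only [map_add, h, h']
    | tmul b x =>
      induction D with
      | zero => simp
      | add _ _ h h' => simp only [map_add, LinearMap.add_apply, h, h']
      | tmul c d => simp [hl]
  right_op_smul a n := by
    obtain ⟨m, rfl⟩ := f.surjective n
    simp only [LinearMap.comp_apply, LinearEquiv.coe_coe, ← hr, LinearEquiv.symm_apply_apply,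
      cM.right_op_smul]
    generalize cM.right m = Z
    generalize (comul a : A ⊗[ℂ] A) = D
    induction Z with
    | zero => simp
    | add _ _ h h' => simp only [map_add, LinearMap.add_apply, h, h']
    | tmul b x =>
      induction D with
      | zero => simp
      | add _ _ h h' => simp only [map_add, h, h']
      | tmul c d => simp [hr]
  left_right_comm n := by
    obtain ⟨m, rfl⟩ := f.surjective n
    simp only [LinearMap.comp_apply, LinearEquiv.coe_coe, LinearEquiv.symm_apply_apply]
    have h1 : ∀ Z : A ⊗[ℂ] M, (f.toLinearMap.rTensor A ∘ₗ cM.right ∘ₗ f.symm.toLinearMap).lTensor A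
        (f.toLinearMap.lTensor A Z) =
          (f.toLinearMap.rTensor A).lTensor A (cM.right.lTensor A Z) := by
      intro Z
      induction Z with
      | zero => simp
      | add _ _ h h' => simp only [map_add, h, h']
      | tmul a x => simp
    have h2 : ∀ Z : M ⊗[ℂ] A, (f.toLinearMap.lTensor A ∘ₗ cM.left ∘ₗ f.symm.toLinearMap).rTensor A
        (f.toLinearMap.rTensor A Z) =
          (f.toLinearMap.lTensor A).rTensor A (cM.left.rTensor A Z) := by
      intro Z
      induction Z with
      | zero => simp
      | add _ _ h h' => simp only [map_add, h, h']
      | tmul a x => simp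
    have h3 : ∀ Z : (A ⊗[ℂ] M) ⊗[ℂ] A, TensorProduct.assoc ℂ A N A
        ((f.toLinearMap.lTensor A).rTensor A Z) =
          (f.toLinearMap.rTensor A).lTensor A (TensorProduct.assoc ℂ A M A Z) := by
      intro Z
      induction Z with
      | zero => simp
      | add _ _ h h' => simp only [map_add, h, h']
      | tmul Y a =>
        induction Y with
        | zero => simp
        | add _ _ h h' => simp only [map_add, add_tmul, h, h']
        | tmul b x => simp
    rw [h1, h2, h3, cM.left_right_comm]

/-- The isomorphism along which a bicovariant structure is transported. -/
def Bicovariant.transportIso (cM : Bicovariant A M) (f : M ≃ₗ[ℂ] N)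
    (hl : ∀ (a : A) (m : M), f (a • m) = a • f m)
    (hr : ∀ (a : A) (m : M), f (op a • m) = op a • f m) :
    BicovariantIso cM (cM.transport f hl hr) :=
  BicovariantIso.ofInverse
    { toLinearMap := f.toLinearMap
      map_smul_left := hl
      map_smul_right := hr
      left_covariant := fun m => by simp [transport]
      right_covariant := fun m => by simp [transport] }
    f.symm.toLinearMap f.symm_apply_apply f.apply_symm_apply

variable (A M) in
/-- The evaluation map `M* ⊗_A M → A`. -/
def RDual.eval : BTensor A (RDual A M) M →ₗ[ℂ] A :=
  BTensor.lift (LinearMap.mk₂ ℂ (fun φ m => φ m) (fun _ _ _ => rfl) (fun _ _ _ => rfl)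
    (fun φ => map_add φ) (fun c φ => RDual.map_csmul φ c)) (fun _ _ _ => rfl)

theorem RDual.eval_mk (φ : RDual A M) (m : M) :
    RDual.eval A M (BTensor.mk A _ M φ m) = φ m := rfl

/-- If the bicovariant structure of `M` is transported to `M*` along `f`, and the pairing
`(m, m') ↦ f(m)(m')` is a morphism, then so is the evaluation map. -/
def evalHom (ev : BicovariantHom (cM.tensor cM) (Bicovariant.unit A)) (f : M ≃ₗ[ℂ] RDual A M)
    (hl : ∀ (a : A) (m : M), f (a • m) = a • f m)
    (hr : ∀ (a : A) (m : M), f (op a • m) = op a • f m)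
    (hf : ∀ m m', f m m' = ev.pairing m m') :
    BicovariantHom ((cM.transport f hl hr).tensor cM) (Bicovariant.unit A) where
  toLinearMap := RDual.eval A M
  map_smul_left a t := by
    induction t using BTensor.induction_on with
    | zero => simp
    | add s t hs ht => simp only [map_add, smul_add, hs, ht]
    | tmul φ m => rfl
  map_smul_right a t := by
    induction t using BTensor.induction_on with
    | zero => simp
    | add s t hs ht => simp only [map_add, smul_add, hs, ht]
    | tmul φ m => exact φ.map_op_smul a m
  left_covariant t := by
    induction t using BTensor.induction_on with
    | zero => simp
    | add s t hs ht => simp only [map_add, hs, ht]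
    | tmul φ m =>
      obtain ⟨n, rfl⟩ := f.surjective φ
      have h : ∀ (Z W : A ⊗[ℂ] M),
          (RDual.eval A M).lTensor A (BTensor.leftPair A _ M (f.toLinearMap.lTensor A Z) W) =
            ev.toLinearMap.lTensor A (BTensor.leftPair A M M Z W) := by
        intro Z W
        induction Z with
        | zero => simp
        | add _ _ h h' => simp only [map_add, LinearMap.add_apply, h, h']
        | tmul a x =>
          induction W with
          | zero => simp
          | add _ _ h h' => simp only [map_add, h, h']
          | tmul b y =>
            simp [BTensor.leftPair, RDual.eval_mk, hf, BicovariantHom.pairing_apply]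
      refine Eq.trans ?_ ((ev.left_covariant (BTensor.mk A M M n m)).trans
        (congrArg comul (hf n m).symm))
      refine Eq.trans ?_ (h (cM.left n) (cM.left m))
      change (RDual.eval A M).lTensor A (BTensor.leftPair A _ M
        (f.toLinearMap.lTensor A (cM.left (f.symm (f n)))) (cM.left m)) = _
      rw [f.symm_apply_apply]
  right_covariant t := by
    induction t using BTensor.induction_on with
    | zero => simp
    | add s t hs ht => simp only [map_add, hs, ht]
    | tmul φ m =>
      obtain ⟨n, rfl⟩ := f.surjective φ
      have h : ∀ (Z W : M ⊗[ℂ] A),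
          (RDual.eval A M).rTensor A (BTensor.rightPair A _ M (f.toLinearMap.rTensor A Z) W) =
            ev.toLinearMap.rTensor A (BTensor.rightPair A M M Z W) := by
        intro Z W
        induction Z with
        | zero => simp
        | add _ _ h h' => simp only [map_add, LinearMap.add_apply, h, h']
        | tmul a x =>
          induction W with
          | zero => simp
          | add _ _ h h' => simp only [map_add, h, h']
          | tmul b y =>
            simp [BTensor.rightPair, RDual.eval_mk, hf, BicovariantHom.pairing_apply]
      refine Eq.trans ?_ ((ev.right_covariant (BTensor.mk A M M n m)).trans
        (congrArg comul (hf n m).symm))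
      refine Eq.trans ?_ (h (cM.right n) (cM.right m))
      change (RDual.eval A M).rTensor A (BTensor.rightPair A _ M
        (f.toLinearMap.rTensor A (cM.right (f.symm (f n)))) (cM.right m)) = _
      rw [f.symm_apply_apply]

/-- The images in `M*` of one half of an invariant dual basis of `M` form, together with the other
half, an invariant dual basis for the evaluation map. -/
def InvariantDualBasis.eval {ι : Type*} [Fintype ι]
    {ev : BicovariantHom (cM.tensor cM) (Bicovariant.unit A)} (D : InvariantDualBasis ev ι)
    (f : M ≃ₗ[ℂ] RDual A M) (hl : ∀ (a : A) (m : M), f (a • m) = a • f m)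
    (hr : ∀ (a : A) (m : M), f (op a • m) = op a • f m)
    (hf : ∀ m m', f m m' = ev.pairing m m') : InvariantDualBasis (evalHom ev f hl hr hf) ι where
  u := D.u
  v i := f (D.v i)
  u_mem := D.u_mem
  v_mem i := by
    rw [Bicovariant.mem_leftInvariant]
    change f.toLinearMap.lTensor A (cM.left (f.symm (f (D.v i)))) = _
    rw [f.symm_apply_apply, (cM.mem_leftInvariant _).1 (D.v_mem i)]
    rfl
  sum_left φ := by
    obtain ⟨m, rfl⟩ := f.surjective φ
    conv_rhs => rw [← D.sum_left m, map_sum]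
    refine Finset.sum_congr rfl fun i _ => ?_
    rw [hl, ← hf]
    rfl
  sum_right m := by
    conv_rhs => rw [← D.sum_right m]
    refine Finset.sum_congr rfl fun i _ => ?_
    rw [← hf]
    rfl

/-! ### Comparison of left duals -/

namespace LeftDual

variable (L : LeftDual cM cX)

/-- The comparison map `X → M*`, `x ↦ ev(x ⊗ -)`, for a left dual `X` of `M`. -/
def toRDual : X →ₗ[ℂ] RDual A M where
  toFun x :=
    ({ toFun := L.ev.pairing x
       map_add' := map_add _
       map_smul' := fun a m => L.ev.pairing_op_smul_right a.unop x m } : M →ₗ[Aᵐᵒᵖ] A)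
  map_add' x y := RDual.ext fun m => by
    change L.ev.pairing (x + y) m = L.ev.pairing x m + L.ev.pairing y m
    rw [map_add, LinearMap.add_apply]
  map_smul' c x := RDual.ext fun m => by
    change L.ev.pairing (c • x) m = c • L.ev.pairing x m
    rw [map_smul, LinearMap.smul_apply]

theorem toRDual_apply (x : X) (m : M) : L.toRDual x m = L.ev.pairing x m := rfl

/-- The map `M ⊗_A X → X`, `m ⊗ x ↦ φ(m) x`. -/
def evalLeft (φ : RDual A M) : BTensor A M X →ₗ[ℂ] X :=
  BTensor.lift (LinearMap.mk₂ ℂ (fun m x => φ m • x) (fun _ _ _ => by rw [map_add, add_smul])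
    (fun _ _ _ => by rw [RDual.map_csmul, smul_assoc]) (fun _ _ _ => smul_add _ _ _)
    (fun c m x => (smul_comm c (φ m) x).symm)) (fun m a x => by
    simp [mul_smul])

theorem evalLeft_mk (φ : RDual A M) (m : M) (x : X) :
    evalLeft φ (BTensor.mk A M X m x) = φ m • x := rfl

theorem evalLeft_toRDual (x : X) : evalLeft (L.toRDual x) (L.coev 1) = x := by
  refine Eq.trans ?_ (L.triangle_right x)
  change _ = BTensor.leftUnitor A X (BTensor.map L.ev (BicovariantHom.id cX)
    ((BTensor.assoc A X M X).symm (BTensor.mk A X _ x (L.coev 1))))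
  generalize L.coev.toLinearMap 1 = t
  induction t using BTensor.induction_on with
  | zero => simp
  | add s t hs ht => simp only [map_add, hs, ht]
  | tmul m y => rfl

theorem toRDual_evalLeft (φ : RDual A M) : L.toRDual (evalLeft φ (L.coev 1)) = φ := by
  refine RDual.ext fun e => ?_
  refine Eq.trans ?_ (congrArg φ (L.triangle_left e))
  change _ = φ (BTensor.rightUnitor A M (BTensor.map (BicovariantHom.id cM) L.ev
    (BTensor.assoc A M X M (BTensor.mk A _ M (L.coev 1) e))))
  generalize L.coev.toLinearMap 1 = t
  induction t using BTensor.induction_on with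
  | zero => simp
  | add s t hs ht => simp only [map_add, LinearMap.add_apply, RDual.add_apply, hs, ht]
  | tmul m y =>
    rw [evalLeft_mk, toRDual_apply, L.ev.pairing_smul]
    exact (φ.map_op_smul (L.ev.pairing y e) m).symm

/-- A left dual `X` of `M` is isomorphic to `M*` by `x ↦ ev(x ⊗ -)`, for any bicovariant structure
on `M*` whose evaluation map is a morphism with an invariant dual basis. The inverse is
`φ ↦ (φ ⊗ id)(coev 1)`. -/
def isoRDual {ι : Type*} [Fintype ι] {cD : Bicovariant A (RDual A M)}
    {ev : BicovariantHom (cD.tensor cM) (Bicovariant.unit A)} (D : InvariantDualBasis ev ι)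
    (hev : ∀ φ m, ev.pairing φ m = φ m) : BicovariantIso cX cD :=
  BicovariantIso.ofInverse
    { toLinearMap := L.toRDual
      map_smul_left := fun a x => RDual.ext fun m => L.ev.pairing_smul a x m
      map_smul_right := fun a x => RDual.ext fun m => L.ev.pairing_op_smul_left a x m
      left_covariant := D.left_covariant_of_pairing L.ev L.toRDual fun x m => hev _ m
      right_covariant := D.right_covariant_of_pairing L.ev L.toRDual fun x m => hev _ m }
    { toFun := fun φ => evalLeft φ (L.coev 1)
      map_add' := fun φ ψ => by
        generalize L.coev.toLinearMap 1 = t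
        induction t using BTensor.induction_on with
        | zero => simp
        | add s t hs ht => simp only [map_add, hs, ht]; abel
        | tmul m y => simp only [evalLeft_mk, RDual.add_apply, add_smul]
      map_smul' := fun c φ => by
        generalize L.coev.toLinearMap 1 = t
        induction t using BTensor.induction_on with
        | zero => simp
        | add s t hs ht => simp only [map_add, hs, ht, smul_add]
        | tmul m y => simp only [evalLeft_mk, RDual.csmul_apply, smul_assoc, RingHom.id_apply] }
    L.evalLeft_toRDual L.toRDual_evalLeft

end LeftDual

/-- The structure on `M*` is determined by the condition that the evaluation map is a morphism. -/
theorem InvariantDualBasis.bicovariant_unique {ι : Type*} [Fintype ι]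
    {cD : Bicovariant A (RDual A M)} {ev : BicovariantHom (cD.tensor cM) (Bicovariant.unit A)}
    (D : InvariantDualBasis ev ι) (hev : ∀ φ m, ev.pairing φ m = φ m)
    (c : Bicovariant A (RDual A M)) (ev' : BicovariantHom (c.tensor cM) (Bicovariant.unit A))
    (hev' : ∀ φ m, ev'.pairing φ m = φ m) : c = cD := by
  have hl : c.left = cD.left := LinearMap.ext fun φ => by
    simpa using D.left_covariant_of_pairing ev' LinearMap.id
      (fun φ m => (hev φ m).trans (hev' φ m).symm) φ
  have hr : c.right = cD.right := LinearMap.ext fun φ => by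
    simpa using D.right_covariant_of_pairing ev' LinearMap.id
      (fun φ m => (hev φ m).trans (hev' φ m).symm) φ
  cases c
  cases cD
  congr

/-- A metric with an invariant dual basis identifies `M` with `M*`: a functional `φ` is the image of
`∑ φ(uᵢ) vᵢ`. -/
theorem metricMap_bijective {g : BTensor A M M →ₗ[Aᵐᵒᵖ] A}
    (hnd : ∀ ρ : M, (∀ ν : M, g (BTensor.mk A M M ρ ν) = 0) → ρ = 0)
    {ev : BicovariantHom (cM.tensor cM) (Bicovariant.unit A)}
    (hev : ∀ m n, ev.pairing m n = metricMap g m n)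
    {ι : Type*} [Fintype ι] (D : InvariantDualBasis ev ι) :
    Function.Bijective (metricMap g) := by
  refine ⟨(injective_iff_map_eq_zero _).2 fun ρ h => hnd ρ fun ν => DFunLike.congr_fun h ν,
    fun φ => ⟨∑ i, φ (D.u i) • D.v i, RDual.ext fun m => ?_⟩⟩
  conv_rhs => rw [← D.sum_right m, map_sum]
  rw [← hev, map_sum, LinearMap.sum_apply]
  refine Finset.sum_congr rfl fun i _ => ?_
  rw [RDual.map_op_smul, ev.pairing_smul]

end HopfBimod

end

open HopfBimod in
theorem mainTheorem8 {A : Type*} [Ring A] [HopfAlgebra ℂ A]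
    {E : Type*} [AddCommGroup E] [Module ℂ E] [Module A E] [Module Aᵐᵒᵖ E]
    [IsScalarTower ℂ A E] [IsScalarTower ℂ Aᵐᵒᵖ E] [SMulCommClass A Aᵐᵒᵖ E]
    (cE : Bicovariant A E) (hfin : FiniteDimensional ℂ cE.leftInvariant)
    (g : BTensor A E E →ₗ[Aᵐᵒᵖ] A) (hg : IsPseudoRiemannianMetric cE g)
    (hglin : ∀ (a : A) (t : BTensor A E E), g (a • t) = a * g t)
    (hgl : IsLeftInvariantMetric cE g) (hgr : IsRightInvariantMetric cE g) :
    ∃ cD : Bicovariant A (RDual A E),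
      -- `E*` with the evaluation map is a left dual of `E`
      (∃ L : LeftDual cE cD, ∀ (φ : RDual A E) (e : E), L.ev (BTensor.mk A _ E φ e) = φ e) ∧
      -- the coactions on `E*` are the only ones for which the evaluation map is a morphism
      (∀ c : Bicovariant A (RDual A E),
        (∃ ev : BicovariantHom (c.tensor cE) (Bicovariant.unit A),
          ∀ (φ : RDual A E) (e : E), ev (BTensor.mk A _ E φ e) = φ e) → c = cD) ∧
      -- `V_g : E → E*` is an isomorphism of bicovariant bimodules
      (∃ V : BicovariantIso cE cD, ∀ e : E, V.hom e = metricMap g e) ∧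
      -- every left dual `X` of `E` is identified with `E*` by `x ↦ ev(x ⊗ -)`, and under this
      -- identification `V_g` is an isomorphism from `E` to `X`
      (∀ {X : Type*} [AddCommGroup X] [Module ℂ X] [Module A X] [Module Aᵐᵒᵖ X]
        [IsScalarTower ℂ A X] [IsScalarTower ℂ Aᵐᵒᵖ X] [SMulCommClass A Aᵐᵒᵖ X]
        (cX : Bicovariant A X) (L : LeftDual cE cX),
        ∃ K : BicovariantIso cX cD,
          (∀ (x : X) (e : E), K.hom x e = L.ev (BTensor.mk A X E x e)) ∧
          ∃ T : BicovariantIso cE cX, ∀ e : E, K.hom (T.hom e) = metricMap g e) := by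
  let ev := metricHom cE g hglin hgl hgr
  have hev : ∀ m n, ev.pairing m n = metricMap g m n := fun _ _ => rfl
  obtain ⟨n, ⟨D⟩⟩ := ev.exists_invariantDualBasis hg.symmetric hg.nondegenerate
  let f := LinearEquiv.ofBijective (metricMap g) (metricMap_bijective hg.nondegenerate hev D)
  have hl : ∀ (a : A) (m : E), f (a • m) = a • f m := fun a m =>
    RDual.ext fun x => ev.pairing_smul a m x
  have hr : ∀ (a : A) (m : E), f (op a • m) = op a • f m := fun a m =>
    RDual.ext fun x => ev.pairing_op_smul_left a m x
  have hf : ∀ m m', f m m' = ev.pairing m m' := fun _ _ => rfl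
  let D' := D.eval f hl hr hf
  have hev' : ∀ φ m, (evalHom ev f hl hr hf).pairing φ m = φ m := fun _ _ => rfl
  refine ⟨cE.transport f hl hr, ⟨D'.leftDual, fun _ _ => rfl⟩, fun c ⟨evc, hc⟩ =>
    D'.bicovariant_unique hev' c evc hc, ⟨cE.transportIso f hl hr, fun _ => rfl⟩, ?_⟩
  intro X _ _ _ _ _ _ _ cX L
  exact ⟨L.isoRDual D' hev', fun _ _ => rfl,
    (cE.transportIso f hl hr).trans (L.isoRDual D' hev').symm,
    fun e => (L.isoRDual D' hev').hom_inv (f e)⟩
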